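/- **Setting.** Fix integers $n_1,n_2\ge 1$, $n=n_1+n_2$, $\eta_k=n_k/n$. For every dimension $p$ and each class $k=1,2$ there are random vectors in $\mathbb R^p$: training observations $X_{k1},\dots,X_{kn_k}$ and test observations $Y$ of class $k$; all of them are independent, those of class $k$ have a common absolutely continuous law with mean $\mu_{(k)}$ and covariance matrix $\Sigma_{(k)}=\sum_{i\le p}\lambda_{(k),i}u_{(k),i}u_{(k),i}^\top$ with $(u_{(k),i})_{i\le p}$ orthonormal. Assume: 1. $p^{-1/2}\|\mu_{(1)}-\mu_{(2)}\|\to\delta>0$ as $p\to\infty$. 2. For fixed $m_k\ge1$, $\beta_k\in[0,1]$, $\sigma_{(k),i}^2>0$, $\tau_{(k),i}^2>0$: $\lambda_{(k),i}=\sigma_{(k),i}^2p^{\beta_k}+\tau_{(k),i}^2$ for $i\le m_k$ and $\lambda_{(k),i}=\tau_{(k),i}^2$ for $i>m_k$; the $\tau_{(k),i}^2$ are uniformly bounded and $p^{-1}\sum_{i\le p}\tau_{(k),i}^2\to\tau_k^2>0$. 3. For every observation $x$ of class $k$, the scores $\lambda_{(k),i}^{-1/2}u_{(k),i}^\top(x-\mu_{(k)})$,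 $i\le p$, are for each $p$ the first $p$ terms of one infinite sequence, which does not depend on $p$, has uniformly bounded fourth moments (uniformly also over the observations), and is $\rho$-mixing after some permutation. 4. For $i\le m_k$ the angle between $u_{(k),i}$ and $\mu_{(1)}-\mu_{(2)}$ converges to some $\theta_{(k),i}\in[0,\pi/2]$. Assume weak spikes: $\beta_1,\beta_2<1$. **Notation.** $\bar X_k$ are the class means and $\bar X$ the total mean of the training data, $d=\bar X_1-\bar X_2$, $S_W=\sum_{k,j}(X_{kj}-\bar X_k)(X_{kj}-\bar X_k)^\top$, $S_B=\sum_k n_k(\bar X_k-\bar X)(\bar X_k-\bar X)^\top$, and $S_X$ is the span of all $X_{kj}-\bar X$. The maximal data piling direction $w_{\rm MDP}$ maximizes $w^\top S_Bw$ over unit vectors $w$ with $w^\top S_Ww=0$, its sign being fixed by $w^\top d\ge0$; $\kappa_{\rm MDP}=p^{-1/2}|w_{\rm MDP}^\top d|$. Let $\hat\lambda_1\ge\dots\ge\hat\lambda_p$ and $\hat u_1,\dots,\hat u_p$ be the eigenvalues and orthonormal eigenvectors of $S_W$. Let $\mathcal U$ be the span of the $u_{(k),i}$, $i\le m_k$,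 over the classes with $\beta_k=1$, and let $\mathcal D$ be the set of $i\le n-2$ such that for some $\epsilon>0$ the probability that $\cos{\rm Angle}(\hat u_i,\mathcal U)>\epsilon$ does not tend to $0$ (the angle to the zero space is $\pi/2$, so here $\mathcal D=\emptyset$). For $\alpha\in\mathbb R$, $v_\alpha$ is the unit vector in the direction of $\sum_{i\in\mathcal D}\frac{\alpha p}{\hat\lambda_i+\alpha p}\hat u_i\hat u_i^\top d+\sum_{i\ge n-1}\hat u_i\hat u_i^\top d$. Let $\mathfrak W_X$ be the set of sequences $\{w\}=(w^{(p)})_p$, $w^{(p)}$ a measurable function of the training data in dimension $p$, such that for all large $p$ almost surely $w^{(p)}\in S_X$ and $\|w^{(p)}\|=1$. Let $\mathcal A$ be the set of $\{w\}\in\mathfrak W_X$ with $p^{-1/2}w^\top(Y-Y')\to0$ in probability for any two test observations $Y,Y'$ of the same class. $D(w)$ is the limit in probability (if it exists; possibly random) of $p^{-1/2}|w^\top(Y_1-Y_2)|$ for test observations $Y_k$ of class $k$. $\{w\}\in\mathcal A$ is second maximal if $D(w)$ exists and $D(v)\le D(w)$ almost surely for all $\{v\}\in\mathcal A$ for which $D(v)$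 exists. **Theorem.** Put $\kappa_0=\left(\delta^2+\tau_1^2/n_1+\tau_2^2/n_2\right)^{1/2}>0$. (a) For every $p\ge n$, almost surely $v_\alpha=w_{\rm MDP}$ for all $\alpha\in\mathbb R$. Moreover $\kappa_{\rm MDP}\to\kappa_0$ in probability. (b) For every test observation $Y$ of class $k$, $p^{-1/2}w_{\rm MDP}^\top(Y-\bar X)$ (and likewise $p^{-1/2}v_\alpha^\top(Y-\bar X)$ for every $\alpha\in\mathbb R$) converges in probability, as $p\to\infty$, to $\kappa_0^{-1}\left(\eta_2\delta^2-(\tau_1^2-\tau_2^2)/n\right)$ if $k=1$ and to $\kappa_0^{-1}\left(-\eta_1\delta^2-(\tau_1^2-\tau_2^2)/n\right)$ if $k=2$. (c) For every $\{w\}\in\mathcal A$ there is $\{v\}\in\mathfrak W_X$ with $\|w-v\|\to0$ in probability; and every $\{w\}\in\mathfrak W_X$ belongs to $\mathcal A$. (d) $\{w_{\rm MDP}\}$ is second maximal, and a sequence $\{w\}\in\mathcal A$ is second maximal if and only if $\min(\|w-w_{\rm MDP}\|,\|w+w_{\rm MDP}\|)\to0$ in probability. -/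

import Mathlib

open MeasureTheory ProbabilityTheory Filter Topology
open scoped ENNReal InnerProductSpace

namespace DoubleDataPiling

/-- Euclidean space of dimension `p`. -/
abbrev E (p : ℕ) := EuclideanSpace ℝ (Fin p)

/-- A training sample in dimension `p`: `n k` vectors from class `k`.
The first class has index `0` and the second class has index `1`. -/
abbrev Sample (n : Fin 2 → ℕ) (p : ℕ) := (k : Fin 2) → Fin (n k) → E p

/-! ### Statistics of a training sample -/

section Statistics

variable {n : Fin 2 → ℕ} {p : ℕ}

/-- The sample mean of class `k`. -/
noncomputable def classMean (x : Sample n p) (k : Fin 2) : E p :=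
  (n k : ℝ)⁻¹ • ∑ j, x k j

/-- The total sample mean (the mean of all observations). -/
noncomputable def totalMean (x : Sample n p) : E p :=
  ((n 0 : ℝ) + n 1)⁻¹ • ∑ k, ∑ j, x k j

/-- The sample mean difference `d`. -/
noncomputable def meanDiff (x : Sample n p) : E p :=
  classMean x 0 - classMean x 1

/-- The within-class scatter matrix `S_W`, as a linear map. -/
noncomputable def withinScatter (x : Sample n p) : E p →ₗ[ℝ] E p :=
  ∑ k, ∑ j, (InnerProductSpace.rankOne ℝ (x k j - classMean x k)
    (x k j - classMean x k)).toLinearMap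

/-- The between-class scatter matrix `S_B`, as a linear map. -/
noncomputable def betweenScatter (x : Sample n p) : E p →ₗ[ℝ] E p :=
  ∑ k, (n k : ℝ) • (InnerProductSpace.rankOne ℝ (classMean x k - totalMean x)
    (classMean x k - totalMean x)).toLinearMap

/-- The sample space `S_X`, spanned by the centred observations. -/
noncomputable def sampleSpace (x : Sample n p) : Submodule ℝ (E p) :=
  Submodule.span ℝ {v | ∃ (k : Fin 2) (j : Fin (n k)), v = x k j - totalMean x}

theorem withinScatter_isSymmetric (x : Sample n p) : (withinScatter x).IsSymmetric := by
  intro v w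
  simp only [withinScatter, LinearMap.sum_apply, sum_inner, inner_sum]
  refine Finset.sum_congr rfl fun k _ => Finset.sum_congr rfl fun j _ => ?_
  simp only [ContinuousLinearMap.coe_coe, InnerProductSpace.rankOne_apply,
    real_inner_smul_left, real_inner_smul_right]
  rw [real_inner_comm v, mul_comm, real_inner_comm w]

/-- The `i`-th eigenvalue (`i = 0, 1, …`) of `S_W`, in descending order with multiplicity. -/
noncomputable def sampleEigval (x : Sample n p) (i : Fin p) : ℝ :=
  (withinScatter_isSymmetric x).eigenvalues finrank_euclideanSpace_fin i

/-- The corresponding unit eigenvectors of `S_W`, which form an orthonormal basis. -/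
noncomputable def sampleEigvec (x : Sample n p) (i : Fin p) : E p :=
  (withinScatter_isSymmetric x).eigenvectorBasis finrank_euclideanSpace_fin i

/-- `w` maximizes `wᵀ S_B w` among the unit vectors with `wᵀ S_W w = 0`; the sign is
fixed by `wᵀ d ≥ 0`. -/
def IsMaximalDataPiling (x : Sample n p) (w : E p) : Prop :=
  ‖w‖ = 1 ∧ ⟪w, withinScatter x w⟫_ℝ = 0 ∧ 0 ≤ ⟪w, meanDiff x⟫_ℝ ∧
    ∀ v : E p, ‖v‖ = 1 → ⟪v, withinScatter x v⟫_ℝ = 0 →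
      ⟪v, betweenScatter x v⟫_ℝ ≤ ⟪w, betweenScatter x w⟫_ℝ

open Classical in
/-- The maximal data piling direction `w_MDP` (zero if there is no unit vector with
`wᵀ S_W w = 0`). -/
noncomputable def mdp (x : Sample n p) : E p :=
  if h : ∃ w, IsMaximalDataPiling x w then h.choose else 0

/-- The training data piling distance `κ_MDP`. -/
noncomputable def kappaMDP (x : Sample n p) : ℝ :=
  (√(p : ℝ))⁻¹ * |⟪mdp x, classMean x 0 - classMean x 1⟫_ℝ|

end Statistics

/-! ### The population model -/

/-- The nonrandom parameters of the two classes. -/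
structure Population where
  /-- mean vector of class `k` in dimension `p` -/
  mean : Fin 2 → (p : ℕ) → E p
  /-- eigenvectors of the covariance matrix of class `k` in dimension `p` -/
  eigvec : Fin 2 → (p : ℕ) → OrthonormalBasis (Fin p) ℝ (E p)
  /-- number of spikes `m_k` -/
  numSpikes : Fin 2 → ℕ
  /-- order of magnitude `β_k` of the spikes -/
  spikeExp : Fin 2 → ℝ
  /-- the coefficients `σ_{(k),i}²` -/
  sigmaSq : Fin 2 → ℕ → ℝ
  /-- the coefficients `τ_{(k),i}²` -/
  tauSq : Fin 2 → ℕ → ℝ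

namespace Population

variable (pop : Population)

/-- The `i`-th eigenvalue of the covariance matrix of class `k` in dimension `p`. -/
noncomputable def eigval (k : Fin 2) (p i : ℕ) : ℝ :=
  (if i < pop.numSpikes k then pop.sigmaSq k i * (p : ℝ) ^ pop.spikeExp k else 0) + pop.tauSq k i

/-- The covariance matrix `Σ_(k)` of class `k` in dimension `p`, as a linear map. -/
noncomputable def covMap (k : Fin 2) (p : ℕ) : E p →ₗ[ℝ] E p :=
  ∑ i : Fin p, pop.eigval k p i •
    (InnerProductSpace.rankOne ℝ (pop.eigvec k p i) (pop.eigvec k p i)).toLinearMap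

/-- The population mean difference `μ`. -/
noncomputable def meanGap (p : ℕ) : E p := pop.mean 0 p - pop.mean 1 p

/-- The common leading eigenspace: the span of the leading eigenvectors of the classes
with strong spikes. -/
def leadingSpace (p : ℕ) : Submodule ℝ (E p) :=
  Submodule.span ℝ {v | ∃ (k : Fin 2) (i : Fin p),
    pop.spikeExp k = 1 ∧ (i : ℕ) < pop.numSpikes k ∧ v = pop.eigvec k p i}

/-- The mean difference has length of exact order `√p`. -/
def MeanGapAsymptotics (δ : ℝ) : Prop :=
  0 < δ ∧ Tendsto (fun p : ℕ => (√(p : ℝ))⁻¹ * ‖pop.meanGap p‖) atTop (𝓝 δ)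

/-- Spiked covariance matrices with average tail eigenvalue `τSq k` in class `k`. -/
structure SpikedCovariances (τSq : Fin 2 → ℝ) : Prop where
  one_le_numSpikes : ∀ k, 1 ≤ pop.numSpikes k
  spikeExp_mem : ∀ k, pop.spikeExp k ∈ Set.Icc (0 : ℝ) 1
  sigmaSq_pos : ∀ k i, i < pop.numSpikes k → 0 < pop.sigmaSq k i
  tauSq_pos : ∀ k i, 0 < pop.tauSq k i
  tauSq_bounded : ∃ C, ∀ k i, pop.tauSq k i ≤ C
  tauSq_average : ∀ k, Tendsto
    (fun p : ℕ => (p : ℝ)⁻¹ * ∑ i ∈ Finset.range p, pop.tauSq k i) atTop (𝓝 (τSq k))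
  limit_pos : ∀ k, 0 < τSq k

/-- The angles between the leading eigenvectors and the mean difference converge. -/
def LimitingAngles (θ : Fin 2 → ℕ → ℝ) : Prop :=
  ∀ k i, i < pop.numSpikes k → θ k i ∈ Set.Icc 0 (Real.pi / 2) ∧
    Tendsto (fun p : ℕ => if h : i < p then
      InnerProductGeometry.angle (pop.eigvec k p ⟨i, h⟩) (pop.meanGap p) else 0)
      atTop (𝓝 (θ k i))

end Population

/-! ### Mixing -/

section Mixing

variable {Ω : Type*} [MeasurableSpace Ω]

/-- The correlation of two real random variables (zero if one of them is degenerate). -/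
noncomputable def corr (P : Measure Ω) (f g : Ω → ℝ) : ℝ :=
  cov[f, g; P] / (√(Var[f; P]) * √(Var[g; P]))

/-- The maximal correlation of two σ-algebras. -/
noncomputable def maxCorr {Ω : Type*} (F G : MeasurableSpace Ω) [MeasurableSpace Ω]
    (P : Measure Ω) : ℝ≥0∞ :=
  ⨆ (f : Ω → ℝ) (g : Ω → ℝ) (_ : Measurable[F] f ∧ MemLp f 2 P)
    (_ : Measurable[G] g ∧ MemLp g 2 P), ENNReal.ofReal |corr P f g|

/-- The σ-algebra generated by the `Z i` with `i` in `I`. -/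
@[reducible]
def sigmaOf (Z : ℕ → Ω → ℝ) (I : Set ℕ) : MeasurableSpace Ω :=
  ⨆ i ∈ I, MeasurableSpace.comap (Z i) inferInstance

/-- The coefficient of ρ-mixing at lag `l`. -/
noncomputable def rhoCoeff (P : Measure Ω) (Z : ℕ → Ω → ℝ) (l : ℕ) : ℝ≥0∞ :=
  ⨆ j : ℕ, maxCorr (sigmaOf Z (Set.Iic j)) (sigmaOf Z (Set.Ici (j + l))) P

/-- The sequence `Z` is ρ-mixing. -/
def RhoMixing (P : Measure Ω) (Z : ℕ → Ω → ℝ) : Prop :=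
  Tendsto (rhoCoeff P Z) atTop (𝓝 0)

end Mixing

/-! ### Training data and independent test data -/

section Data

variable {Ω : Type*} [MeasurableSpace Ω]

/-- The observations. In dimension `p`, the vector `X p k (Sum.inl j)` is the `j`-th training
observation of class `k`, and `X p k (Sum.inr l)` is the `l`-th test observation of class `k`.
The variable `z k o i` is the `i`-th principal component score of observation `o` of class `k`. -/
structure IsObservationModel (P : Measure Ω) (pop : Population) (n : Fin 2 → ℕ)
    (X : (p : ℕ) → (k : Fin 2) → Fin (n k) ⊕ ℕ → Ω → E p)
    (z : (k : Fin 2) → Fin (n k) ⊕ ℕ → ℕ → Ω → ℝ) : Prop where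
  measurable : ∀ p k o, Measurable (X p k o)
  memLp : ∀ p k o, MemLp (X p k o) 2 P
  /-- all training and test observations are independent -/
  indep : ∀ p, iIndepFun (fun (s : Σ k : Fin 2, Fin (n k) ⊕ ℕ) => X p s.1 s.2) P
  /-- observations of the same class are identically distributed -/
  identDistrib : ∀ p k o o', IdentDistrib (X p k o) (X p k o') P P
  absolutelyContinuous : ∀ p k o, P.map (X p k o) ≪ volume
  mean_eq : ∀ p k o, ∫ ω, X p k o ω ∂P = pop.mean k p
  cov_eq : ∀ p k o (a b : E p),
    cov[fun ω => ⟪a, X p k o ω⟫_ℝ, fun ω => ⟪b, X p k o ω⟫_ℝ; P] = ⟪a, pop.covMap k p b⟫_ℝ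
  /-- for every `p`, the scores are the first `p` terms of one infinite sequence -/
  score_eq : ∀ p k o (i : Fin p) ω,
    z k o i ω = (√(pop.eigval k p i))⁻¹ * ⟪pop.eigvec k p i, X p k o ω - pop.mean k p⟫_ℝ
  fourth_moments : ∃ C, ∀ k o i, MemLp (z k o i) 4 P ∧ ∫ ω, z k o i ω ^ 4 ∂P ≤ C
  mixing : ∀ k o, ∃ π : Equiv.Perm ℕ, RhoMixing P (fun i => z k o (π i))

variable (P : Measure Ω) (pop : Population) {n : Fin 2 → ℕ}
  (X : (p : ℕ) → (k : Fin 2) → Fin (n k) ⊕ ℕ → Ω → E p)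

/-- The training sample in dimension `p`. -/
def train (p : ℕ) (ω : Ω) : Sample n p := fun k j => X p k (Sum.inl j) ω

/-- The `l`-th independent test observation of class `k` in dimension `p`. -/
def test (p : ℕ) (k : Fin 2) (l : ℕ) (ω : Ω) : E p := X p k (Sum.inr l) ω

/-- The index set `𝒟`: the index `i` (counted from `0`) of a sample eigenvector belongs to it
if, for some `ε > 0`, the probability that the cosine of the angle between the `i`-th sample
eigenvector and the common leading eigenspace exceeds `ε` does not tend to `0`. The angle
between a vector and the zero space is `π / 2`. -/
def signalIndices : Set ℕ :=
  {i | i < n 0 + n 1 - 2 ∧ ∃ ε : ℝ, 0 < ε ∧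
    ¬ Tendsto (fun p : ℕ => P {ω | ∃ h : i < p,
        ε < Real.cos (InnerProductGeometry.angle (sampleEigvec (train X p ω) ⟨i, h⟩)
          ((pop.leadingSpace p).starProjection (sampleEigvec (train X p ω) ⟨i, h⟩)))})
      atTop (𝓝 0)}

open Classical in
/-- The unnormalized projected ridged linear discriminant vector with ridge parameter `α p`,
at the sample `x`. -/
noncomputable def ridgeVector (α : ℝ) {p : ℕ} (x : Sample n p) : E p :=
  (∑ i ∈ Finset.univ.filter (fun i : Fin p => (i : ℕ) ∈ signalIndices P pop X),
      (α * p / (sampleEigval x i + α * p)) • ⟪sampleEigvec x i, meanDiff x⟫_ℝ • sampleEigvec x i)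
    + ∑ i ∈ Finset.univ.filter (fun i : Fin p => n 0 + n 1 - 2 ≤ (i : ℕ)),
      ⟪sampleEigvec x i, meanDiff x⟫_ℝ • sampleEigvec x i

/-- The projected ridged linear discriminant vector `v_α`. -/
noncomputable def projectedRidge (α : ℝ) {p : ℕ} (x : Sample n p) : E p :=
  ‖ridgeVector P pop X α x‖⁻¹ • ridgeVector P pop X α x

/-! ### Second data piling -/

/-- `𝔚_X`: sequences of unit directions in the sample space. The direction in dimension `p` is
a (measurable) function `w p` of the training sample. -/
def directions : Set ((p : ℕ) → Sample n p → E p) :=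
  {w | ∀ᶠ p : ℕ in atTop, AEMeasurable (w p) (P.map (train X p)) ∧
    ∀ᵐ ω ∂P, w p (train X p ω) ∈ sampleSpace (train X p ω) ∧ ‖w p (train X p ω)‖ = 1}

/-- `𝒜`: sequences of second data piling directions. -/
def secondDataPiling : Set ((p : ℕ) → Sample n p → E p) :=
  {w | w ∈ directions P X ∧ ∀ k l l', TendstoInMeasure P
    (fun (p : ℕ) ω => (√(p : ℝ))⁻¹ * ⟪w p (train X p ω), test X p k l ω - test X p k l' ω⟫_ℝ)
    atTop (fun _ => 0)}

/-- `D` is the asymptotic distance `D(w)` between the two piles of test data along `w`: the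
limit in probability (possibly random) of `p ^ (-1/2) |wᵀ (Y₁ - Y₂)|`. -/
def HasPilingDistance (w : (p : ℕ) → Sample n p → E p) (D : Ω → ℝ) : Prop :=
  ∀ l l', TendstoInMeasure P
    (fun (p : ℕ) ω => (√(p : ℝ))⁻¹ * |⟪w p (train X p ω), test X p 0 l ω - test X p 1 l' ω⟫_ℝ|)
    atTop D

/-- `w` is a sequence of second maximal data piling directions: it belongs to `𝒜`, and `D(w)`
exists and is maximal among the existing distances of members of `𝒜`. -/
def IsSecondMaximal (w : (p : ℕ) → Sample n p → E p) : Prop :=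
  w ∈ secondDataPiling P X ∧ ∃ D, HasPilingDistance P X w D ∧
    ∀ v ∈ secondDataPiling P X, ∀ D', HasPilingDistance P X v D' → D' ≤ᵐ[P] D

end Data

end DoubleDataPiling

open DoubleDataPiling

/-! Centre all observations at the mean of the second class. With weak spikes the largest population
eigenvalue is o(p). Deviations of different observations are therefore asymptotically orthogonal to
each other and to the mean gap at scale p, while ρ-mixing gives a law of large numbers for their
squared lengths. Hence the scaled Gram matrix of training and test data has a deterministic limit
(`gramLimit`, `WeakSpikeModel.gramTendsto_shifted`), and the rest is geometry of that limit.

Almost surely the training vectors are linearly independent, so the kernel of S_W belongs exactly to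
the eigenvalues from index n - 2 on (counted from 0). The maximal data piling direction is the
normalized projection `kernelDiff` of d onto this kernel. No class has strong spikes, so 𝒟 is empty
and v_α is the same vector.

Two facts carry the limits. Zero-sum combinations of training vectors satisfy ‖Σ b x‖² ≥ c p Σ b²
uniformly in b (`WeakSpikeModel.exists_coercive`). Hence a vector V whose scaled inner products with
all training vectors have one common limit is asymptotically invisible to every direction in S_X
(`WeakSpikeModel.tendsto_inner_direction`). The same argument inside each class shows that the part
of d in the range of S_W is negligible, so w_MDP behaves like d / ‖d‖ and ‖d‖ / √p → κ₀.

For V = Y - Y' with both test points in one class, this says that every direction in S_X piles. For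
V = Y₁ - Y₂ - r d with r = δ² / κ₀² it shows that the test distance along w is asymptotically (δ² /
κ₀) |wᵀ w_MDP|. Cauchy–Schwarz and its equality case then identify the second maximal directions.

Convergence in probability is expressed as convergence along one filter on ℕ × Ω, so that the
ordinary calculus of limits applies and events may quantify over all coefficient vectors at once. -/

namespace DoubleDataPiling

/-! ### Linear algebra of a fixed sample: the kernel of S_W and the maximal data piling direction.
-/

section Geometry

variable {n : Fin 2 → ℕ} {p : ℕ}

/-- The linear combination of the observations with coefficients `b`. -/
noncomputable def combo (x : Sample n p) : ((k : Fin 2) → Fin (n k) → ℝ) →ₗ[ℝ] E p where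
  toFun b := ∑ k, ∑ j, b k j • x k j
  map_add' b c := by simp only [Pi.add_apply, add_smul, Finset.sum_add_distrib]
  map_smul' r b := by simp only [Pi.smul_apply, smul_eq_mul, mul_smul, Finset.smul_sum,
    RingHom.id_apply]

theorem combo_apply (x : Sample n p) (b : (k : Fin 2) → Fin (n k) → ℝ) :
    combo x b = ∑ k, ∑ j, b k j • x k j := rfl

/-- The sums of the coefficients over the two classes. -/
noncomputable def classSum (n : Fin 2 → ℕ) :
    ((k : Fin 2) → Fin (n k) → ℝ) →ₗ[ℝ] (Fin 2 → ℝ) where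
  toFun b k := ∑ j, b k j
  map_add' b c := by ext k; simp [Finset.sum_add_distrib]
  map_smul' r b := by ext k; simp [Finset.mul_sum]

theorem classSum_apply (b : (k : Fin 2) → Fin (n k) → ℝ) (k : Fin 2) :
    classSum n b k = ∑ j, b k j := rfl

/-- The span of the observations centred at their class means. -/
noncomputable def withinSpace (x : Sample n p) : Submodule ℝ (E p) :=
  Submodule.span ℝ {v | ∃ (k : Fin 2) (j : Fin (n k)), v = x k j - classMean x k}

theorem sum_eq_smul_classMean {x : Sample n p} {k : Fin 2} (hk : 1 ≤ n k) :
    ∑ j, x k j = (n k : ℝ) • classMean x k := by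
  rw [classMean, smul_smul, mul_inv_cancel₀ (by positivity), one_smul]

theorem combo_eq_sum_sub (x : Sample n p) (m : Fin 2 → E p) (b : (k : Fin 2) → Fin (n k) → ℝ) :
    combo x b = ∑ k, ∑ j, b k j • (x k j - m k) + ∑ k, classSum n b k • m k := by
  simp only [combo_apply, classSum_apply, smul_sub, Finset.sum_sub_distrib, Finset.sum_smul]
  abel

/-- Passing to coefficients with zero class sums serves twice: it gives the dimension n - 2 under
linear independence, and it makes the coercivity bound applicable to vectors of this span. -/
theorem withinSpace_eq_map (hn : ∀ k, 1 ≤ n k) (x : Sample n p) :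
    withinSpace x = (LinearMap.ker (classSum n)).map (combo x) := by
  apply le_antisymm
  · rw [withinSpace, Submodule.span_le]
    rintro v ⟨k, j, rfl⟩
    -- Coefficients of one observation minus its class mean: a unit mass minus the uniform weight 1
    -- / n k, on class k only.
    refine ⟨Pi.single k (Pi.single j 1 - fun _ => (n k : ℝ)⁻¹), ?_, ?_⟩
    · rw [SetLike.mem_coe, LinearMap.mem_ker]
      ext l
      rw [classSum_apply]
      rcases eq_or_ne l k with rfl | h
      · have : (n l : ℝ) ≠ 0 := by have := hn l; positivity
        simp [this]
      · simp [Pi.single_eq_of_ne h]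
    · rw [combo_apply, Finset.sum_eq_single k]
      · simp [sub_smul, Finset.sum_sub_distrib, classMean, Finset.smul_sum, Pi.single_apply]
      · intro l _ h
        simp [Pi.single_eq_of_ne h]
      · simp
  · rintro v ⟨b, hb, rfl⟩
    rw [SetLike.mem_coe, LinearMap.mem_ker] at hb
    rw [combo_eq_sum_sub x (classMean x), hb]
    simp only [Pi.zero_apply, zero_smul, Finset.sum_const_zero, add_zero]
    exact Submodule.sum_mem _ fun k _ => Submodule.sum_mem _ fun j _ =>
      Submodule.smul_mem _ _ (Submodule.subset_span ⟨k, j, rfl⟩)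

theorem exists_combo_of_mem_sampleSpace (hn : ∀ k, 1 ≤ n k) {x : Sample n p} {v : E p}
    (hv : v ∈ sampleSpace x) : ∃ b, ∑ k, classSum n b k = 0 ∧ combo x b = v := by
  let K : Submodule ℝ ((k : Fin 2) → Fin (n k) → ℝ) :=
    { carrier := {b | ∑ k, classSum n b k = 0}
      add_mem' := by
        intro a b ha hb
        simp only [Set.mem_ofPred_eq] at *
        simp [Finset.sum_add_distrib] at *
        linarith
      zero_mem' := by simp
      smul_mem' := by
        intro c b hb
        simp only [Set.mem_ofPred_eq, map_smul, Pi.smul_apply, ← Finset.smul_sum] at *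
        rw [hb, smul_zero] }
  have : sampleSpace x ≤ K.map (combo x) := by
    rw [sampleSpace, Submodule.span_le]
    rintro v ⟨k, j, rfl⟩
    have hN : ((n 0 : ℝ) + n 1) ≠ 0 := by have := hn 0; positivity
    refine ⟨Pi.single k (Pi.single j 1) - fun _ _ => ((n 0 : ℝ) + n 1)⁻¹, ?_, ?_⟩
    · change _ = _
      rw [map_sub]
      simp only [Pi.sub_apply, Finset.sum_sub_distrib, classSum_apply]
      rw [Finset.sum_eq_single k]
      · simp only [Pi.single_eq_same, Finset.sum_pi_single', Finset.mem_univ, if_true,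
          Finset.sum_const, Finset.card_univ, Fintype.card_fin, nsmul_eq_mul, Fin.sum_univ_two]
        field_simp
        simp
      · intro l _ h
        simp [Pi.single_eq_of_ne h]
      · simp
    · rw [map_sub, combo_apply, Finset.sum_eq_single k]
      · simp [Pi.single_apply, combo_apply, totalMean, Finset.smul_sum]
      · intro l _ h
        simp [Pi.single_eq_of_ne h]
      · simp
  obtain ⟨b, hb, rfl⟩ := this hv
  exact ⟨b, hb, rfl⟩

theorem classMean_sub_totalMean_mem (hn : ∀ k, 1 ≤ n k) (x : Sample n p) (k : Fin 2) :
    classMean x k - totalMean x ∈ sampleSpace x := by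
  have hk : (n k : ℝ) ≠ 0 := by have := hn k; positivity
  have : classMean x k - totalMean x = (n k : ℝ)⁻¹ • ∑ j, (x k j - totalMean x) := by
    rw [Finset.sum_sub_distrib, smul_sub, classMean]
    simp [← Nat.cast_smul_eq_nsmul ℝ, smul_smul, hk]
  rw [this]
  exact Submodule.smul_mem _ _ (Submodule.sum_mem _ fun j _ => Submodule.subset_span ⟨k, j, rfl⟩)

theorem withinSpace_le_sampleSpace (hn : ∀ k, 1 ≤ n k) (x : Sample n p) :
    withinSpace x ≤ sampleSpace x := by
  rw [withinSpace, Submodule.span_le]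
  rintro v ⟨k, j, rfl⟩
  have := Submodule.sub_mem _ (Submodule.subset_span ⟨k, j, rfl⟩ :
    x k j - totalMean x ∈ sampleSpace x) (classMean_sub_totalMean_mem hn x k)
  rwa [sub_sub_sub_cancel_right] at this

theorem meanDiff_mem_sampleSpace (hn : ∀ k, 1 ≤ n k) (x : Sample n p) :
    meanDiff x ∈ sampleSpace x := by
  have := Submodule.sub_mem _ (classMean_sub_totalMean_mem hn x 0)
    (classMean_sub_totalMean_mem hn x 1)
  simpa [meanDiff] using this

theorem withinScatter_apply (x : Sample n p) (v : E p) :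
    withinScatter x v = ∑ k, ∑ j, ⟪x k j - classMean x k, v⟫_ℝ • (x k j - classMean x k) := by
  simp only [withinScatter, LinearMap.sum_apply, ContinuousLinearMap.coe_coe,
    InnerProductSpace.rankOne_apply]

theorem inner_withinScatter (x : Sample n p) (v : E p) :
    ⟪v, withinScatter x v⟫_ℝ = ∑ k, ∑ j, ⟪x k j - classMean x k, v⟫_ℝ ^ 2 := by
  simp only [withinScatter_apply, inner_sum, real_inner_smul_right]
  refine Finset.sum_congr rfl fun k _ => Finset.sum_congr rfl fun j _ => ?_
  rw [real_inner_comm v, sq]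

/-- The quadratic form is a sum of squares, so it vanishes only if every summand does. -/
theorem inner_withinScatter_eq_zero_iff (x : Sample n p) (v : E p) :
    ⟪v, withinScatter x v⟫_ℝ = 0 ↔ v ∈ (withinSpace x)ᗮ := by
  rw [inner_withinScatter, Finset.sum_eq_zero_iff_of_nonneg
    (fun k _ => Finset.sum_nonneg fun j _ => sq_nonneg _), withinSpace,
    Submodule.mem_orthogonal]
  constructor
  · intro h u hu
    induction hu using Submodule.span_induction with
    | mem u hu =>
      obtain ⟨k, j, rfl⟩ := hu
      have := (Finset.sum_eq_zero_iff_of_nonneg (fun j _ => sq_nonneg _)).1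
        (h k (Finset.mem_univ _)) j (Finset.mem_univ _)
      simpa using this
    | zero => simp
    | add a b _ _ ha hb => rw [inner_add_left, ha, hb, add_zero]
    | smul c a _ ha => rw [real_inner_smul_left, ha, mul_zero]
  · intro h k _
    exact Finset.sum_eq_zero fun j _ => by
      rw [h _ (Submodule.subset_span ⟨k, j, rfl⟩)]; simp

theorem ker_withinScatter (x : Sample n p) :
    LinearMap.ker (withinScatter x) = (withinSpace x)ᗮ := by
  ext v
  rw [← inner_withinScatter_eq_zero_iff, LinearMap.mem_ker]
  constructor
  · intro h; rw [h, inner_zero_right]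
  · intro h
    rw [inner_withinScatter_eq_zero_iff, Submodule.mem_orthogonal] at h
    rw [withinScatter_apply]
    exact Finset.sum_eq_zero fun k _ => Finset.sum_eq_zero fun j _ => by
      rw [h _ (Submodule.subset_span ⟨k, j, rfl⟩), zero_smul]

theorem withinScatter_sampleEigvec (x : Sample n p) (i : Fin p) :
    withinScatter x (sampleEigvec x i) = sampleEigval x i • sampleEigvec x i := by
  simp [sampleEigvec, sampleEigval, LinearMap.IsSymmetric.apply_eigenvectorBasis]

theorem sampleEigval_eq_inner (x : Sample n p) (i : Fin p) :
    sampleEigval x i = ⟪sampleEigvec x i, withinScatter x (sampleEigvec x i)⟫_ℝ := by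
  rw [withinScatter_sampleEigvec, real_inner_smul_right, real_inner_self_eq_norm_sq, sampleEigvec,
    OrthonormalBasis.norm_eq_one]
  simp

theorem sampleEigval_nonneg (x : Sample n p) (i : Fin p) : 0 ≤ sampleEigval x i := by
  rw [sampleEigval_eq_inner, inner_withinScatter]
  positivity

theorem sampleEigval_le (x : Sample n p) (i : Fin p) :
    sampleEigval x i ≤ ∑ k, ∑ j, ‖x k j - classMean x k‖ ^ 2 := by
  rw [sampleEigval_eq_inner, inner_withinScatter]
  refine Finset.sum_le_sum fun k _ => Finset.sum_le_sum fun j _ => ?_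
  have := abs_real_inner_le_norm (x k j - classMean x k) (sampleEigvec x i)
  have h1 : ‖sampleEigvec x i‖ = 1 := OrthonormalBasis.norm_eq_one _ _
  rw [h1, mul_one] at this
  exact sq_le_sq' (by linarith [(abs_le.1 this).1]) (abs_le.1 this).2

theorem classSum_surjective (hn : ∀ k, 1 ≤ n k) : Function.Surjective (classSum n) := by
  intro a
  refine ⟨fun k _ => (n k : ℝ)⁻¹ * a k, ?_⟩
  ext k
  have : (n k : ℝ) ≠ 0 := by have := hn k; positivity
  simp [classSum_apply, this]

/-- The space is isomorphic to the kernel of the surjection `classSum` onto a plane, hence of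
codimension 2 in the n coefficients. -/
theorem finrank_withinSpace (hn : ∀ k, 1 ≤ n k) {x : Sample n p}
    (hx : Function.Injective (combo x)) :
    Module.finrank ℝ (withinSpace x) + 2 = n 0 + n 1 := by
  rw [withinSpace_eq_map hn, (Submodule.equivMapOfInjective _ hx _).symm.finrank_eq]
  have h := LinearMap.finrank_range_add_finrank_ker (classSum n)
  rw [LinearMap.range_eq_top.2 (classSum_surjective hn), finrank_top] at h
  simp [Module.finrank_pi_fintype] at h
  omega

/-- The zeros of a nonnegative antitone function form a final segment, so counting them determines
where the segment starts. -/
theorem antitone_eq_zero_iff {f : Fin p → ℝ} (hf : Antitone f) (h0 : ∀ i, 0 ≤ f i) {r : ℕ}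
    (hr : (Finset.univ.filter fun i => f i = 0).card + r = p) (i : Fin p) :
    f i = 0 ↔ r ≤ (i : ℕ) := by
  have hc := Finset.card_filter_add_card_filter_not (s := Finset.univ) (fun i => f i = 0)
  rw [Finset.card_univ, Fintype.card_fin] at hc
  have hr' : (Finset.univ.filter fun i => ¬ f i = 0).card = r := by omega
  constructor
  · intro hi
    by_contra! h
    have : (Finset.univ.filter fun i => ¬ f i = 0) ⊆ Finset.Iio i := by
      intro j hj
      rw [Finset.mem_filter] at hj
      rw [Finset.mem_Iio]
      by_contra! hij
      exact hj.2 (le_antisymm (hi ▸ hf hij) (h0 j))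
    have := Finset.card_le_card this
    rw [Fin.card_Iio] at this
    omega
  · intro h
    by_contra hi
    have : Finset.Iic i ⊆ Finset.univ.filter fun i => ¬ f i = 0 := by
      intro j hj
      rw [Finset.mem_Iic] at hj
      rw [Finset.mem_filter]
      refine ⟨Finset.mem_univ _, fun hj0 => hi (le_antisymm (hj0 ▸ hf hj) (h0 i))⟩
    have := Finset.card_le_card this
    rw [Fin.card_Iic] at this
    omega

theorem sampleEigval_eq_zero_iff (hn : ∀ k, 1 ≤ n k) {x : Sample n p}
    (hx : Function.Injective (combo x)) (i : Fin p) :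
    sampleEigval x i = 0 ↔ n 0 + n 1 - 2 ≤ (i : ℕ) := by
  have hcard := (withinScatter_isSymmetric x).card_filter_eigenvalues_eq
    finrank_euclideanSpace_fin 0
  have h1 := Submodule.finrank_add_finrank_orthogonal (withinSpace x)
  have h2 := finrank_withinSpace hn hx
  rw [finrank_euclideanSpace_fin] at h1
  rw [Module.End.eigenspace_zero, ker_withinScatter] at hcard
  refine antitone_eq_zero_iff
    ((withinScatter_isSymmetric x).eigenvalues_antitone finrank_euclideanSpace_fin)
    (sampleEigval_nonneg x) ?_ i
  have hcard' : (Finset.univ.filter fun i => (withinScatter_isSymmetric x).eigenvalues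
      finrank_euclideanSpace_fin i = 0).card = Module.finrank ℝ (withinSpace x)ᗮ := hcard
  rw [hcard']
  omega

/-- The projection of the mean difference onto the kernel of `S_W`. -/
noncomputable def kernelDiff (x : Sample n p) : E p :=
  ∑ i, (if sampleEigval x i = 0 then ⟪sampleEigvec x i, meanDiff x⟫_ℝ else 0) • sampleEigvec x i

theorem sum_inner_sampleEigvec (x : Sample n p) (v : E p) :
    ∑ i, ⟪sampleEigvec x i, v⟫_ℝ • sampleEigvec x i = v :=
  ((withinScatter_isSymmetric x).eigenvectorBasis finrank_euclideanSpace_fin).sum_repr' v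

theorem kernelDiff_mem (x : Sample n p) : kernelDiff x ∈ (withinSpace x)ᗮ := by
  rw [← ker_withinScatter, LinearMap.mem_ker, kernelDiff, map_sum]
  refine Finset.sum_eq_zero fun i _ => ?_
  rw [map_smul, withinScatter_sampleEigvec]
  split_ifs with h
  · rw [h, zero_smul, smul_zero]
  · rw [zero_smul]

theorem withinScatter_mem (x : Sample n p) (v : E p) : withinScatter x v ∈ withinSpace x := by
  rw [withinScatter_apply]
  exact Submodule.sum_mem _ fun k _ => Submodule.sum_mem _ fun j _ =>
    Submodule.smul_mem _ _ (Submodule.subset_span ⟨k, j, rfl⟩)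

/-- Only eigenvectors with nonzero eigenvalue remain in the difference. Each of them is a multiple
of its image under S_W, which lies in the span of the within-class deviations. -/
theorem meanDiff_sub_kernelDiff_mem (x : Sample n p) :
    meanDiff x - kernelDiff x ∈ withinSpace x := by
  have h : meanDiff x - kernelDiff x = ∑ i, (⟪sampleEigvec x i, meanDiff x⟫_ℝ • sampleEigvec x i -
      (if sampleEigval x i = 0 then ⟪sampleEigvec x i, meanDiff x⟫_ℝ else 0) •
        sampleEigvec x i) := by
    rw [Finset.sum_sub_distrib, sum_inner_sampleEigvec, kernelDiff]
  rw [h]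
  refine Submodule.sum_mem _ fun i _ => ?_
  split_ifs with h
  · simp
  · rw [zero_smul, sub_zero]
    refine Submodule.smul_mem _ _ ?_
    have := withinScatter_mem x (sampleEigvec x i)
    rw [withinScatter_sampleEigvec] at this
    exact (Submodule.smul_mem_iff _ h).1 this

theorem kernelDiff_mem_sampleSpace (hn : ∀ k, 1 ≤ n k) (x : Sample n p) :
    kernelDiff x ∈ sampleSpace x := by
  have := Submodule.sub_mem _ (meanDiff_mem_sampleSpace hn x)
    (withinSpace_le_sampleSpace hn x (meanDiff_sub_kernelDiff_mem x))
  rwa [sub_sub_cancel] at this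

/-- Otherwise d would be a combination with zero class sums. Its own coefficients have class sums 1
and -1, and coefficients are unique by injectivity. -/
theorem kernelDiff_ne_zero (hn : ∀ k, 1 ≤ n k) {x : Sample n p}
    (hx : Function.Injective (combo x)) : kernelDiff x ≠ 0 := by
  intro h
  have hd := meanDiff_sub_kernelDiff_mem x
  rw [h, sub_zero, withinSpace_eq_map hn] at hd
  obtain ⟨b, hb, hbd⟩ := hd
  rw [SetLike.mem_coe, LinearMap.mem_ker] at hb
  have h0 : (n 0 : ℝ) ≠ 0 := by have := hn 0; positivity
  have : combo x (fun k _ => if k = 0 then (n k : ℝ)⁻¹ else -(n k : ℝ)⁻¹) = meanDiff x := by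
    simp [combo_apply, meanDiff, classMean, Finset.smul_sum, sub_eq_add_neg]
  rw [← hx (this.trans hbd.symm)] at hb
  have := congrFun hb 0
  rw [classSum_apply] at this
  simp [h0] at this

theorem totalMean_eq (hn : ∀ k, 1 ≤ n k) (x : Sample n p) :
    totalMean x = ((n 0 : ℝ) + n 1)⁻¹ • ((n 0 : ℝ) • classMean x 0 + (n 1 : ℝ) • classMean x 1) := by
  rw [totalMean, Fin.sum_univ_two, sum_eq_smul_classMean (hn 0), sum_eq_smul_classMean (hn 1)]

theorem inner_betweenScatter (hn : ∀ k, 1 ≤ n k) (x : Sample n p) (v : E p) :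
    ⟪v, betweenScatter x v⟫_ℝ = (n 0 * n 1 / (n 0 + n 1) : ℝ) * ⟪v, meanDiff x⟫_ℝ ^ 2 := by
  have hN : ((n 0 : ℝ) + n 1) ≠ 0 := by have := hn 0; positivity
  rw [betweenScatter, LinearMap.sum_apply]
  simp only [LinearMap.smul_apply, ContinuousLinearMap.coe_coe, InnerProductSpace.rankOne_apply,
    real_inner_smul_right, Fin.sum_univ_two, real_inner_comm v, inner_sub_right,
    meanDiff, totalMean_eq hn, inner_add_right]
  field_simp
  ring

theorem inner_meanDiff_eq (x : Sample n p) {v : E p} (hv : v ∈ (withinSpace x)ᗮ) :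
    ⟪v, meanDiff x⟫_ℝ = ⟪v, kernelDiff x⟫_ℝ := by
  have := (Submodule.mem_orthogonal' _ _).1 hv _ (meanDiff_sub_kernelDiff_mem x)
  rwa [inner_sub_right, sub_eq_zero] at this

/-- S_B acts as a positive multiple of (vᵀ d)², and on the kernel of S_W the vector d may be
replaced by its projection. The maximizer is then given by equality in Cauchy–Schwarz. Uniqueness
matters because `mdp` is defined by choice. -/
theorem isMaximalDataPiling_iff (hn : ∀ k, 1 ≤ n k) {x : Sample n p}
    (hr : kernelDiff x ≠ 0) (w : E p) :
    IsMaximalDataPiling x w ↔ w = ‖kernelDiff x‖⁻¹ • kernelDiff x := by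
  have hr' : 0 < ‖kernelDiff x‖ := norm_pos_iff.2 hr
  have hc : (0 : ℝ) < n 0 * n 1 / (n 0 + n 1) := by
    have := hn 0; have := hn 1; positivity
  have hu : ‖‖kernelDiff x‖⁻¹ • kernelDiff x‖ = 1 := by
    rw [norm_smul, norm_inv, norm_norm, inv_mul_cancel₀ hr'.ne']
  have hu' := Submodule.smul_mem _ ‖kernelDiff x‖⁻¹ (kernelDiff_mem x)
  have hur : ⟪‖kernelDiff x‖⁻¹ • kernelDiff x, meanDiff x⟫_ℝ = ‖kernelDiff x‖ := by
    rw [inner_meanDiff_eq x hu', real_inner_smul_left, real_inner_self_eq_norm_sq]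
    field_simp
  constructor
  · rintro ⟨h1, h2, h3, h4⟩
    rw [inner_withinScatter_eq_zero_iff] at h2
    have h5 := h4 _ hu ((inner_withinScatter_eq_zero_iff x _).2 hu')
    rw [inner_betweenScatter hn, inner_betweenScatter hn, hur] at h5
    have h6 : ‖kernelDiff x‖ ≤ ⟪w, meanDiff x⟫_ℝ :=
      le_of_sq_le_sq (le_of_mul_le_mul_left h5 hc) h3
    rw [inner_meanDiff_eq x h2] at h6
    have h7 : ⟪w, ‖kernelDiff x‖⁻¹ • kernelDiff x⟫_ℝ = 1 := by
      apply le_antisymm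
      · have := real_inner_le_norm w (‖kernelDiff x‖⁻¹ • kernelDiff x)
        rwa [h1, hu, one_mul] at this
      · rw [real_inner_smul_right, ← inv_mul_cancel₀ hr'.ne']
        gcongr
    exact (inner_eq_one_iff_of_norm_eq_one h1 hu).1 h7
  · rintro rfl
    refine ⟨hu, (inner_withinScatter_eq_zero_iff x _).2 hu', by rw [hur]; exact hr'.le, ?_⟩
    intro v hv1 hv2
    rw [inner_withinScatter_eq_zero_iff] at hv2
    rw [inner_betweenScatter hn, inner_betweenScatter hn, hur, inner_meanDiff_eq x hv2]
    have := abs_real_inner_le_norm v (kernelDiff x)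
    rw [hv1, one_mul] at this
    exact mul_le_mul_of_nonneg_left (by rwa [sq_le_sq, abs_norm]) hc.le

theorem mdp_eq (hn : ∀ k, 1 ≤ n k) {x : Sample n p} (hr : kernelDiff x ≠ 0) :
    mdp x = ‖kernelDiff x‖⁻¹ • kernelDiff x := by
  have h : ∃ w, IsMaximalDataPiling x w := ⟨_, (isMaximalDataPiling_iff hn hr _).2 rfl⟩
  rw [mdp, dif_pos h]
  exact (isMaximalDataPiling_iff hn hr _).1 h.choose_spec

/-- The iterates of I - S_W / B damp every eigencomponent with positive eigenvalue, since B = 1 + tr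
S_W exceeds all eigenvalues, and fix the kernel. This exhibits the projection as a limit of explicit
functions of the sample, so its measurability needs no measurable choice of eigenvectors. -/
theorem tendsto_iterate_kernelDiff (x : Sample n p) :
    Tendsto (fun m : ℕ => (fun v : E p => v - (1 + ∑ k, ∑ j, ‖x k j - classMean x k‖ ^ 2)⁻¹ •
      withinScatter x v)^[m] (meanDiff x)) atTop (𝓝 (kernelDiff x)) := by
  set B : ℝ := 1 + ∑ k, ∑ j, ‖x k j - classMean x k‖ ^ 2 with hB
  have hB0 : 0 < B := by positivity
  have key : ∀ m : ℕ, (fun v : E p => v - B⁻¹ • withinScatter x v)^[m] (meanDiff x) =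
      ∑ i, ((1 - B⁻¹ * sampleEigval x i) ^ m * ⟪sampleEigvec x i, meanDiff x⟫_ℝ) •
        sampleEigvec x i := by
    intro m
    induction m with
    | zero => simp [sum_inner_sampleEigvec]
    | succ m ih =>
      rw [Function.iterate_succ_apply', ih]
      simp only [map_sum, map_smul, withinScatter_sampleEigvec, Finset.smul_sum,
        ← Finset.sum_sub_distrib]
      refine Finset.sum_congr rfl fun i _ => ?_
      rw [smul_smul, smul_smul, ← sub_smul]
      congr 1
      ring
  simp only [key, kernelDiff]
  refine tendsto_finsetSum _ fun i _ => Tendsto.smul_const ?_ _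
  have h1 := sampleEigval_le x i
  split_ifs with h
  · simp [h]
  · rw [← zero_mul ⟪sampleEigvec x i, meanDiff x⟫_ℝ]
    refine Tendsto.mul_const _ (tendsto_pow_atTop_nhds_zero_of_lt_one ?_ ?_)
    · rw [sub_nonneg, inv_mul_le_iff₀ hB0]
      linarith
    · have := (sampleEigval_nonneg x i).lt_of_ne' h
      have : 0 < B⁻¹ * sampleEigval x i := by positivity
      linarith

theorem measurable_classMean (k : Fin 2) :
    Measurable (fun x : Sample n p => classMean x k) := by
  unfold classMean; fun_prop

theorem measurable_kernelDiff : Measurable (fun x : Sample n p => kernelDiff x) := by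
  refine measurable_of_tendsto_metrizable (f := fun (m : ℕ) (x : Sample n p) =>
    (fun v : E p => v - (1 + ∑ k, ∑ j, ‖x k j - classMean x k‖ ^ 2)⁻¹ •
      withinScatter x v)^[m] (meanDiff x)) (fun m => ?_)
    (tendsto_pi_nhds.2 tendsto_iterate_kernelDiff)
  have hm := measurable_classMean (n := n) (p := p)
  induction m with
  | zero => simp only [Function.iterate_zero, id]; unfold meanDiff; fun_prop
  | succ m ih =>
    simp only [Function.iterate_succ_apply']
    have step : ∀ g : Sample n p → E p, Measurable g → Measurable fun x : Sample n p =>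
        g x - (1 + ∑ k, ∑ j, ‖x k j - classMean x k‖ ^ 2)⁻¹ • withinScatter x (g x) := by
      intro g hg
      simp only [withinScatter_apply]
      fun_prop
    exact step _ ih

end Geometry

/-! ### Almost sure linear independence of the observations. -/

section GeneralPosition

variable {Ω : Type*} [MeasurableSpace Ω] {P : Measure Ω} [IsProbabilityMeasure P]

/-- Independent vectors with absolutely continuous laws are almost surely linearly independent. -/
theorem ae_linearIndependent {p m : ℕ} (hm : m ≤ p) {V : Fin m → Ω → E p}
    (hV : ∀ i, Measurable (V i)) (hind : iIndepFun V P) (hac : ∀ i, P.map (V i) ≪ volume) :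
    ∀ᵐ ω ∂P, LinearIndependent ℝ (fun i => V i ω) := by
  induction m with
  | zero => exact Eventually.of_forall fun ω => linearIndependent_empty_type
  | succ m ih =>
    have h1 := ih (by omega) (V := fun i => V i.succ) (fun i => hV _)
      (hind.precomp (Fin.succ_injective m)) (fun i => hac _)
    have h2 : IndepFun (fun ω (i : Fin m) => V i.succ ω) (V 0) P := by
      have h := hind.indepFun_finset (Finset.univ.erase 0) {0} (by simp) hV
      have hφ : Measurable fun (f : (Finset.univ.erase (0 : Fin (m + 1)) : Finset _) → E p)
          (i : Fin m) => f ⟨i.succ, by simp [Fin.succ_ne_zero]⟩ :=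
        measurable_pi_lambda _ fun i => measurable_pi_apply _
      have hψ : Measurable fun (f : ({0} : Finset (Fin (m + 1))) → E p) => f ⟨0, by simp⟩ :=
        measurable_pi_apply _
      exact h.comp hφ hψ
    have hm1 : Measurable (fun ω (i : Fin m) => V i.succ ω) := by fun_prop
    have h3 := (indepFun_iff_map_prod_eq_prod_map_map hm1.aemeasurable
      (hV 0).aemeasurable).1 h2
    have hmeas : MeasurableSet {q : (Fin m → E p) × E p |
        LinearIndependent ℝ (Fin.cons q.2 q.1 : Fin (m + 1) → E p)} := by
      refine IsOpen.measurableSet ?_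
      have hc : Continuous fun q : (Fin m → E p) × E p =>
          (Fin.cons q.2 q.1 : Fin (m + 1) → E p) := by
        refine continuous_pi fun i => ?_
        refine Fin.cases ?_ (fun i => ?_) i
        · simpa using continuous_snd
        · simpa using! (continuous_apply i).comp continuous_fst
      exact isOpen_setOfPred_linearIndependent.preimage hc
    have h4 : ∀ᵐ q ∂(P.map (fun ω (i : Fin m) => V i.succ ω)).prod (P.map (V 0)),
        LinearIndependent ℝ (Fin.cons q.2 q.1 : Fin (m + 1) → E p) := by
      -- Fubini: given the other m vectors, the remaining one must avoid their span. Since m < p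
      -- this is a proper subspace, null for Lebesgue measure and so for the absolutely continuous
      -- law.
      refine Measure.measure_prod_null_of_ae_null hmeas.compl ?_
      have hmeas' : MeasurableSet {f : Fin m → E p | LinearIndependent ℝ f} :=
        isOpen_setOfPred_linearIndependent.measurableSet
      filter_upwards [(ae_map_iff hm1.aemeasurable hmeas').2 h1] with y hy
      have hlt : Submodule.span ℝ (Set.range y) ≠ ⊤ := by
        intro h
        have := finrank_span_eq_card hy
        rw [h, finrank_top, finrank_euclideanSpace_fin, Fintype.card_fin] at this
        omega
      refine measure_mono_null ?_ ((hac 0) (Measure.addHaar_submodule volume _ hlt))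
      intro v hv
      by_contra hv'
      exact hv (linearIndependent_finCons.2 ⟨hy, hv'⟩)
    rw [← h3] at h4
    have h5 := ae_of_ae_map (by fun_prop) h4
    filter_upwards [h5] with ω hω
    convert hω using 1
    ext i
    refine Fin.cases ?_ (fun i => ?_) i <;> simp

theorem ae_linearIndependent_fintype {p : ℕ} {ι : Type*} [Fintype ι] (hm : Fintype.card ι ≤ p)
    {V : ι → Ω → E p} (hV : ∀ i, Measurable (V i)) (hind : iIndepFun V P)
    (hac : ∀ i, P.map (V i) ≪ volume) : ∀ᵐ ω ∂P, LinearIndependent ℝ (fun i => V i ω) := by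
  have e := (Fintype.equivFin ι).symm
  filter_upwards [ae_linearIndependent hm (V := fun i => V (e i)) (fun i => hV _)
    (hind.precomp e.injective) (fun i => hac _)] with ω hω
  exact (linearIndependent_equiv e).1 hω

theorem combo_injective {n : Fin 2 → ℕ} {p : ℕ} {x : Sample n p}
    (hx : LinearIndependent ℝ (fun s : Σ k, Fin (n k) => x s.1 s.2)) :
    Function.Injective (combo x) := by
  rw [injective_iff_map_eq_zero]
  intro b hb
  ext k j
  refine Fintype.linearIndependent_iff.1 hx (fun s => b s.1 s.2) ?_ ⟨k, j⟩
  rw [Fintype.sum_sigma]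
  exact hb

end GeneralPosition

/-! ### Almost sure form of w_MDP and of v_α under the model. -/

section Model

variable {Ω : Type*} [MeasurableSpace Ω] {P : Measure Ω}
  {pop : Population} {n : Fin 2 → ℕ} {X : (p : ℕ) → (k : Fin 2) → Fin (n k) ⊕ ℕ → Ω → E p}
  {z : (k : Fin 2) → Fin (n k) ⊕ ℕ → ℕ → Ω → ℝ}

theorem IsObservationModel.measurable_train (hobs : IsObservationModel P pop n X z) (p : ℕ) :
    Measurable (train X p) :=
  measurable_pi_lambda _ fun k => measurable_pi_lambda _ fun _ => hobs.measurable p k _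

theorem IsObservationModel.ae_linearIndependent_train [IsProbabilityMeasure P]
    (hobs : IsObservationModel P pop n X z)
    {p : ℕ} (hp : n 0 + n 1 ≤ p) : ∀ᵐ ω ∂P,
      LinearIndependent ℝ (fun s : Σ k, Fin (n k) => train X p ω s.1 s.2) := by
  refine ae_linearIndependent_fintype (V := fun (s : Σ k, Fin (n k)) => X p s.1 (Sum.inl s.2))
    (by simpa using hp) (fun s => hobs.measurable _ _ _) ?_
    (fun s => hobs.absolutelyContinuous _ _ _)
  refine (hobs.indep p).precomp (g := fun s : Σ k, Fin (n k) => ⟨s.1, Sum.inl s.2⟩) ?_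
  rintro ⟨k, j⟩ ⟨l, i⟩ h
  simp only [Sigma.mk.injEq] at h
  obtain ⟨rfl, h⟩ := h
  simpa using h

theorem IsObservationModel.ae_combo_injective [IsProbabilityMeasure P]
    (hobs : IsObservationModel P pop n X z)
    {p : ℕ} (hp : n 0 + n 1 ≤ p) : ∀ᵐ ω ∂P, Function.Injective (combo (train X p ω)) := by
  filter_upwards [hobs.ae_linearIndependent_train hp] with ω hω using combo_injective hω

/-- Measurability of a direction refers to the law of the training sample, so general position is
also needed under that law. The transfer goes through linear independence, which is an open
condition. -/
theorem IsObservationModel.ae_map_combo_injective [IsProbabilityMeasure P]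
    (hobs : IsObservationModel P pop n X z)
    {p : ℕ} (hp : n 0 + n 1 ≤ p) : ∀ᵐ x ∂(P.map (train X p)), Function.Injective (combo x) := by
  have hm : MeasurableSet {x : Sample n p |
      LinearIndependent ℝ (fun s : Σ k, Fin (n k) => x s.1 s.2)} := by
    refine IsOpen.measurableSet ?_
    have hc : Continuous fun (x : Sample n p) (s : Σ k, Fin (n k)) => x s.1 s.2 := by fun_prop
    exact isOpen_setOfPred_linearIndependent.preimage hc
  filter_upwards [(ae_map_iff (hobs.measurable_train p).aemeasurable hm).2
    (hobs.ae_linearIndependent_train hp)] with x hx using combo_injective hx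

theorem IsObservationModel.ae_mdp_eq [IsProbabilityMeasure P]
    (hn : ∀ k, 1 ≤ n k) (hobs : IsObservationModel P pop n X z)
    {p : ℕ} (hp : n 0 + n 1 ≤ p) : ∀ᵐ ω ∂P, kernelDiff (train X p ω) ≠ 0 ∧
      mdp (train X p ω) = ‖kernelDiff (train X p ω)‖⁻¹ • kernelDiff (train X p ω) := by
  filter_upwards [hobs.ae_combo_injective hp] with ω hω
  exact ⟨kernelDiff_ne_zero hn hω, mdp_eq hn (kernelDiff_ne_zero hn hω)⟩

theorem IsObservationModel.mdp_mem_directions [IsProbabilityMeasure P]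
    (hn : ∀ k, 1 ≤ n k)
    (hobs : IsObservationModel P pop n X z) : (fun _ x => mdp x) ∈ directions P X := by
  filter_upwards [eventually_ge_atTop (n 0 + n 1)] with p hp
  constructor
  · refine AEMeasurable.congr (f := fun x => ‖kernelDiff x‖⁻¹ • kernelDiff x) ?_ ?_
    · have := measurable_kernelDiff (n := n) (p := p)
      exact (by fun_prop : Measurable fun x : Sample n p =>
        ‖kernelDiff x‖⁻¹ • kernelDiff x).aemeasurable
    · filter_upwards [hobs.ae_map_combo_injective hp] with x hx
      exact (mdp_eq hn (kernelDiff_ne_zero hn hx)).symm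
  · filter_upwards [hobs.ae_mdp_eq hn hp] with ω ⟨h1, h2⟩
    rw [h2]
    refine ⟨Submodule.smul_mem _ _ (kernelDiff_mem_sampleSpace hn _), ?_⟩
    rw [norm_smul, norm_inv, norm_norm, inv_mul_cancel₀ (norm_ne_zero_iff.2 h1)]

/-- Without a class of exponent 1 the leading space is zero, the projection vanishes, and the angle
to the zero vector is π / 2, with cosine 0. -/
theorem signalIndices_eq_empty (hweak : ∀ k, pop.spikeExp k < 1) :
    signalIndices P pop X = ∅ := by
  have hbot : ∀ p, pop.leadingSpace p = ⊥ := by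
    intro p
    rw [Population.leadingSpace, Submodule.span_eq_bot]
    rintro v ⟨k, i, h, -⟩
    exact absurd h (hweak k).ne
  rw [Set.eq_empty_iff_forall_notMem]
  rintro i ⟨-, ε, hε, h⟩
  apply h
  simp [hbot, hε.not_gt]

theorem IsObservationModel.ae_projectedRidge_eq_mdp [IsProbabilityMeasure P]
    (hn : ∀ k, 1 ≤ n k)
    (hobs : IsObservationModel P pop n X z) (hweak : ∀ k, pop.spikeExp k < 1)
    {p : ℕ} (hp : n 0 + n 1 ≤ p) : ∀ᵐ ω ∂P, ∀ α : ℝ,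
      projectedRidge P pop X α (train X p ω) = mdp (train X p ω) := by
  filter_upwards [hobs.ae_combo_injective hp] with ω hω α
  rw [mdp_eq hn (kernelDiff_ne_zero hn hω), projectedRidge]
  have : ridgeVector P pop X α (train X p ω) = kernelDiff (train X p ω) := by
    rw [ridgeVector, signalIndices_eq_empty hweak, kernelDiff]
    simp only [Set.mem_empty_iff_false, Finset.filter_false, Finset.sum_empty, zero_add,
      Finset.sum_filter, sampleEigval_eq_zero_iff hn hω, ite_smul, zero_smul]
  rw [this]

end Model

/-! ### Convergence in probability as convergence along a filter. -/

section ConvergenceInProbability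

variable {Ω : Type*} [MeasurableSpace Ω]

/-- The filter on `ℕ × Ω` along which convergence is convergence in probability. -/
def probFilter (P : Measure Ω) : Filter (ℕ × Ω) where
  sets := {S | Tendsto (fun p : ℕ => P {ω | (p, ω) ∉ S}) atTop (𝓝 0)}
  univ_sets := by simp
  sets_of_superset := by
    intro S T hS hST
    exact tendsto_of_tendsto_of_tendsto_of_le_of_le tendsto_const_nhds hS (fun _ => zero_le)
      fun p => measure_mono fun ω hω h => hω (hST h)
  inter_sets := by
    intro S T hS hT
    have h := Tendsto.add hS hT
    rw [add_zero] at h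
    refine tendsto_of_tendsto_of_tendsto_of_le_of_le tendsto_const_nhds h (fun _ => zero_le)
      fun p => (measure_mono fun ω hω => ?_).trans (measure_union_le _ _)
    by_cases h1 : (p, ω) ∈ S
    · exact Or.inr fun h2 => hω ⟨h1, h2⟩
    · exact Or.inl h1

variable {P : Measure Ω}

theorem eventually_probFilter {Q : ℕ × Ω → Prop} : (∀ᶠ q in probFilter P, Q q) ↔
    Tendsto (fun p : ℕ => P {ω | ¬ Q (p, ω)}) atTop (𝓝 0) := Iff.rfl

theorem eventually_probFilter_of_ae {Q : ℕ × Ω → Prop}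
    (h : ∀ᶠ p in atTop, ∀ᵐ ω ∂P, Q (p, ω)) : ∀ᶠ q in probFilter P, Q q := by
  rw [eventually_probFilter]
  refine tendsto_const_nhds.congr' ?_
  filter_upwards [h] with p hp
  exact (ae_iff.1 hp).symm

theorem tendsto_fst_probFilter : Tendsto Prod.fst (probFilter P) (atTop : Filter ℕ) := by
  intro S hS
  exact eventually_probFilter_of_ae (by
    filter_upwards [hS] with p hp using Eventually.of_forall fun _ => hp)

/-- The limit may be random, so the statement concerns the difference and not convergence to a
point. -/
theorem tendstoInMeasure_iff_sub {f : ℕ → Ω → ℝ} {g : Ω → ℝ} :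
    TendstoInMeasure P f atTop g ↔
      Tendsto (fun q : ℕ × Ω => f q.1 q.2 - g q.2) (probFilter P) (𝓝 0) := by
  rw [tendstoInMeasure_iff_norm, Metric.tendsto_nhds]
  refine forall_congr' fun ε => forall_congr' fun _ => ?_
  rw [eventually_probFilter]
  simp only [dist_zero_right, not_lt]

theorem tendstoInMeasure_iff {f : ℕ → Ω → ℝ} {c : ℝ} :
    TendstoInMeasure P f atTop (fun _ => c) ↔
      Tendsto (fun q : ℕ × Ω => f q.1 q.2) (probFilter P) (𝓝 c) := by
  rw [tendstoInMeasure_iff_sub, tendsto_sub_nhds_zero_iff]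

/-- Chebyshev's inequality: convergence to zero in mean square implies convergence in
probability. -/
theorem tendsto_probFilter_of_integral_sq [IsFiniteMeasure P] {f : ℕ → Ω → ℝ} {a : ℕ → ℝ}
    (hf : ∀ p, Integrable (fun ω => f p ω ^ 2) P) (hfa : ∀ᶠ p in atTop, ∫ ω, f p ω ^ 2 ∂P ≤ a p)
    (ha : Tendsto a atTop (𝓝 0)) :
    Tendsto (fun q : ℕ × Ω => f q.1 q.2) (probFilter P) (𝓝 0) := by
  rw [Metric.tendsto_nhds]
  intro ε hε
  rw [eventually_probFilter]
  simp only [dist_zero_right, not_lt, Real.norm_eq_abs]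
  have key : ∀ᶠ p in atTop, P {ω | ε ≤ |f p ω|} ≤ ENNReal.ofReal (a p / ε ^ 2) := by
    filter_upwards [hfa] with p hp
    have h1 := mul_meas_ge_le_integral_of_nonneg (μ := P)
      (ae_of_all _ fun ω => sq_nonneg (f p ω)) (hf p) (ε ^ 2)
    have h2 : {ω | ε ≤ |f p ω|} ⊆ {ω | ε ^ 2 ≤ f p ω ^ 2} := by
      intro ω hω
      have hω' : ε ≤ |f p ω| := hω
      change ε ^ 2 ≤ f p ω ^ 2
      rw [← sq_abs (f p ω)]
      gcongr
    refine (measure_mono h2).trans ?_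
    rw [← ofReal_measureReal]
    refine ENNReal.ofReal_le_ofReal ?_
    rw [le_div_iff₀ (by positivity), mul_comm]
    exact h1.trans hp
  refine tendsto_of_tendsto_of_tendsto_of_le_of_le' tendsto_const_nhds ?_
    (Eventually.of_forall fun _ => zero_le) key
  have := ENNReal.tendsto_ofReal (ha.div_const (ε ^ 2))
  simpa using this

/-- The event D > c + ε does not involve p, so its probability can tend to 0 only by being 0. Then ε
runs through 1 / (m + 1). -/
theorem ae_le_of_probFilter {c : ℝ} {D : Ω → ℝ}
    (h : ∀ ε > 0, ∀ᶠ q in probFilter P, D q.2 ≤ c + ε) : ∀ᵐ ω ∂P, D ω ≤ c := by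
  have : ∀ m : ℕ, ∀ᵐ ω ∂P, D ω ≤ c + 1 / ((m : ℝ) + 1) := by
    intro m
    rw [ae_iff]
    have h1 := eventually_probFilter.1 (h (1 / ((m : ℝ) + 1)) (by positivity))
    exact tendsto_nhds_unique tendsto_const_nhds h1
  filter_upwards [ae_all_iff.2 this] with ω hω
  have hlim : Tendsto (fun m : ℕ => c + 1 / ((m : ℝ) + 1)) atTop (𝓝 (c + 0)) :=
    tendsto_const_nhds.add tendsto_one_div_add_atTop_nhds_zero_nat
  rw [add_zero] at hlim
  exact ge_of_tendsto' hlim hω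

end ConvergenceInProbability

/-! ### Eigenvalue bounds for weakly spiked covariance matrices. -/

namespace Population

variable {pop : Population} {τSq : Fin 2 → ℝ}

theorem SpikedCovariances.eigval_pos (hcov : pop.SpikedCovariances τSq) (k : Fin 2) {p : ℕ}
    (hp : 1 ≤ p) (i : ℕ) : 0 < pop.eigval k p i := by
  have h1 := hcov.tauSq_pos k i
  have hp' : (0 : ℝ) < p := by exact_mod_cast hp
  rw [eigval]
  split_ifs with h
  · have := hcov.sigmaSq_pos k i h
    positivity
  · linarith

theorem tendsto_inv_mul_rpow {β : ℝ} (hβ : β < 1) :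
    Tendsto (fun p : ℕ => (p : ℝ)⁻¹ * (p : ℝ) ^ β) atTop (𝓝 0) := by
  have h := (tendsto_rpow_neg_atTop (y := 1 - β) (by linarith)).comp tendsto_natCast_atTop_atTop
  refine h.congr' ?_
  filter_upwards [eventually_ge_atTop 1] with p hp
  have hp' : (0 : ℝ) < p := by exact_mod_cast hp
  rw [Function.comp_apply, ← Real.rpow_neg_one, ← Real.rpow_add hp']
  congr 1
  ring

/-- The bound Λ(p) = o(p) on all eigenvalues is what makes cross terms negligible. Summing all spike
coefficients avoids taking a maximum. -/
theorem SpikedCovariances.exists_eigval_le (hcov : pop.SpikedCovariances τSq) (k : Fin 2)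
    (hweak : pop.spikeExp k < 1) : ∃ Λ : ℕ → ℝ, (∀ p, 1 ≤ p → ∀ i, pop.eigval k p i ≤ Λ p) ∧
      Tendsto (fun p : ℕ => (p : ℝ)⁻¹ * Λ p) atTop (𝓝 0) := by
  obtain ⟨C, hC⟩ := hcov.tauSq_bounded
  refine ⟨fun p => (∑ i ∈ Finset.range (pop.numSpikes k), pop.sigmaSq k i) *
    (p : ℝ) ^ pop.spikeExp k + C, ?_, ?_⟩
  · intro p hp i
    rw [eigval]
    refine add_le_add ?_ (hC k i)
    have h0 : ∀ i ∈ Finset.range (pop.numSpikes k), 0 ≤ pop.sigmaSq k i := fun i hi =>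
      (hcov.sigmaSq_pos k i (Finset.mem_range.1 hi)).le
    split_ifs with h
    · exact mul_le_mul_of_nonneg_right
        (Finset.single_le_sum h0 (Finset.mem_range.2 h)) (by positivity)
    · exact mul_nonneg (Finset.sum_nonneg h0) (by positivity)
  · have h1 := (tendsto_inv_mul_rpow hweak).const_mul
      (∑ i ∈ Finset.range (pop.numSpikes k), pop.sigmaSq k i)
    have h2 := (tendsto_inv_atTop_nhds_zero_nat (𝕜 := ℝ)).mul_const C
    have h3 := h1.add h2
    simp only [mul_zero, zero_mul, add_zero] at h3
    refine h3.congr fun p => ?_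
    ring

/-- The finitely many spikes add only O(p ^ (β - 1)) to the average. -/
theorem SpikedCovariances.tendsto_average_eigval (hcov : pop.SpikedCovariances τSq) (k : Fin 2)
    (hweak : pop.spikeExp k < 1) :
    Tendsto (fun p : ℕ => (p : ℝ)⁻¹ * ∑ i : Fin p, pop.eigval k p i) atTop (𝓝 (τSq k)) := by
  have h1 := (tendsto_inv_mul_rpow hweak).const_mul
    (∑ i ∈ Finset.range (pop.numSpikes k), pop.sigmaSq k i)
  have h2 := h1.add (hcov.tauSq_average k)
  rw [mul_zero, zero_add] at h2
  refine h2.congr' ?_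
  filter_upwards [eventually_ge_atTop (pop.numSpikes k)] with p hp
  rw [Fin.sum_univ_eq_sum_range (fun i => pop.eigval k p i)]
  simp only [eigval, Finset.sum_add_distrib]
  rw [← Finset.sum_filter]
  have : (Finset.range p).filter (fun i => i < pop.numSpikes k) =
      Finset.range (pop.numSpikes k) := by
    ext i
    simp only [Finset.mem_filter, Finset.mem_range]
    omega
  rw [this, ← Finset.sum_mul]
  ring

theorem inner_covMap (k : Fin 2) (p : ℕ) (a b : E p) :
    ⟪a, pop.covMap k p b⟫_ℝ =
      ∑ i : Fin p, pop.eigval k p i * (⟪pop.eigvec k p i, a⟫_ℝ * ⟪pop.eigvec k p i, b⟫_ℝ) := by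
  rw [covMap, LinearMap.sum_apply, inner_sum]
  refine Finset.sum_congr rfl fun i _ => ?_
  rw [LinearMap.smul_apply, ContinuousLinearMap.coe_coe, InnerProductSpace.rankOne_apply,
    real_inner_smul_right, real_inner_smul_right, real_inner_comm a]
  ring

theorem inner_eigvec_covMap (k : Fin 2) (p : ℕ) (i j : Fin p) :
    ⟪pop.eigvec k p i, pop.covMap k p (pop.eigvec k p j)⟫_ℝ =
      if i = j then pop.eigval k p i else 0 := by
  rw [inner_covMap]
  simp only [OrthonormalBasis.inner_eq_ite]
  rcases eq_or_ne i j with rfl | h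
  · simp
  · simp [h, h.symm]

theorem inner_covMap_self_le {k : Fin 2} {p : ℕ} {Λ : ℝ}
    (hΛ : ∀ i, pop.eigval k p i ≤ Λ) (a : E p) :
    ⟪a, pop.covMap k p a⟫_ℝ ≤ Λ * ‖a‖ ^ 2 := by
  rw [inner_covMap, ← (pop.eigvec k p).sum_sq_norm_inner_right a, Finset.mul_sum]
  refine Finset.sum_le_sum fun i _ => ?_
  rw [Real.norm_eq_abs, sq_abs, ← sq]
  exact mul_le_mul_of_nonneg_right (hΛ i) (sq_nonneg _)

end Population

/-! ### Covariances of squared scores under ρ-mixing. -/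

section Mixing

theorem measurable_sigmaOf {Ω : Type*} {Z : ℕ → Ω → ℝ} {I : Set ℕ} {i : ℕ} (hi : i ∈ I) :
    Measurable[sigmaOf Z I] (Z i) :=
  (comap_measurable (Z i)).mono (le_iSup₂_of_le i hi le_rfl) le_rfl

theorem ofReal_abs_corr_sq_le_rhoCoeff {Ω : Type*} [MeasurableSpace Ω] {P : Measure Ω}
    {Z : ℕ → Ω → ℝ} (i j : ℕ)
    (hi : MemLp (fun ω => Z i ω ^ 2) 2 P) (hj : MemLp (fun ω => Z (i + j) ω ^ 2) 2 P) :
    ENNReal.ofReal |corr P (fun ω => Z i ω ^ 2) (fun ω => Z (i + j) ω ^ 2)| ≤ rhoCoeff P Z j := by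
  refine le_trans ?_ (le_iSup _ i)
  exact le_iSup_of_le (fun ω => Z i ω ^ 2) (le_iSup_of_le (fun ω => Z (i + j) ω ^ 2)
    (le_iSup_of_le ⟨(measurable_sigmaOf (Set.mem_Iic.2 le_rfl)).pow_const 2, hi⟩
      (le_iSup_of_le ⟨(measurable_sigmaOf (Set.mem_Ici.2 le_rfl)).pow_const 2, hj⟩ le_rfl)))

variable {Ω : Type*} [MeasurableSpace Ω] {P : Measure Ω} [IsProbabilityMeasure P]

theorem abs_covariance_le {f g : Ω → ℝ} (hf : MemLp f 2 P) (hg : MemLp g 2 P) {C : ℝ}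
    (hfC : Var[f; P] ≤ C) (hgC : Var[g; P] ≤ C) : |cov[f, g; P]| ≤ C := by
  have h1 := variance_nonneg (fun ω => f ω + g ω) P
  have h2 := variance_nonneg (fun ω => f ω - g ω) P
  rw [variance_fun_add hf hg] at h1
  rw [variance_fun_sub hf hg] at h2
  rw [abs_le]
  constructor <;> linarith

theorem covariance_eq_zero_of_variance_eq_zero {f g : Ω → ℝ} (hf : MemLp f 2 P)
    (h : Var[f; P] = 0) : cov[f, g; P] = 0 := by
  rw [covariance]
  refine integral_eq_zero_of_ae ?_
  filter_upwards [ae_eq_integral_of_variance_eq_zero hf h] with ω hω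
  simp [hω]

theorem abs_covariance_le_of_abs_corr_le {f g : Ω → ℝ} (hf : MemLp f 2 P) (hg : MemLp g 2 P)
    {C ε : ℝ} (hε : 0 ≤ ε) (hfC : Var[f; P] ≤ C) (hgC : Var[g; P] ≤ C)
    (h : |corr P f g| ≤ ε) : |cov[f, g; P]| ≤ ε * C := by
  have hC : 0 ≤ C := (variance_nonneg f P).trans hfC
  -- For a degenerate variable `corr` is 0 by division by zero and carries no information; the
  -- covariance vanishes directly.
  rcases (variance_nonneg f P).eq_or_lt with hf0 | hf0
  · rw [covariance_eq_zero_of_variance_eq_zero hf hf0.symm, abs_zero]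
    positivity
  rcases (variance_nonneg g P).eq_or_lt with hg0 | hg0
  · rw [covariance_comm, covariance_eq_zero_of_variance_eq_zero hg hg0.symm, abs_zero]
    positivity
  have h1 : √(Var[f; P]) * √(Var[g; P]) ≤ C := by
    rw [← Real.mul_self_sqrt hC]
    gcongr
  have h2 : 0 < √(Var[f; P]) * √(Var[g; P]) := by positivity
  rw [corr, abs_div, abs_of_pos h2, div_le_iff₀ h2] at h
  exact h.trans (by gcongr)

/-- Squares of a mixing sequence with bounded fourth moments are almost uncorrelated at large
lags. -/
theorem exists_abs_covariance_sq_le {Z : ℕ → Ω → ℝ} {π : Equiv.Perm ℕ} {C : ℝ}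
    (hL : ∀ i, MemLp (fun ω => Z i ω ^ 2) 2 P) (hC : ∀ i, Var[fun ω => Z i ω ^ 2; P] ≤ C)
    (hmix : RhoMixing P (fun i => Z (π i))) {ε : ℝ} (hε : 0 < ε) :
    ∃ L : ℕ, ∀ i j, L ≤ Nat.dist (π.symm i) (π.symm j) →
      |cov[fun ω => Z i ω ^ 2, fun ω => Z j ω ^ 2; P]| ≤ ε * C := by
  have h1 := (ENNReal.tendsto_atTop_zero.1 hmix) (ENNReal.ofReal ε) (by simpa using hε)
  obtain ⟨L, hLε⟩ := h1
  have key : ∀ a b, L ≤ b →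
      |cov[fun ω => Z (π a) ω ^ 2, fun ω => Z (π (a + b)) ω ^ 2; P]| ≤ ε * C := by
    intro a b hb
    refine abs_covariance_le_of_abs_corr_le (hL _) (hL _) hε.le (hC _) (hC _) ?_
    have := (ofReal_abs_corr_sq_le_rhoCoeff (Z := fun i => Z (π i)) a b (hL _) (hL _)).trans
      (hLε b hb)
    exact (ENNReal.ofReal_le_ofReal_iff hε.le).1 this
  refine ⟨L, fun i j hij => ?_⟩
  rcases le_total (π.symm i) (π.symm j) with h | h
  · rw [Nat.dist_eq_sub_of_le h] at hij
    have := key (π.symm i) (π.symm j - π.symm i) hij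
    rwa [Nat.add_sub_cancel' h, Equiv.apply_symm_apply, Equiv.apply_symm_apply] at this
  · rw [Nat.dist_eq_sub_of_le_right h] at hij
    have := key (π.symm j) (π.symm i - π.symm j) hij
    rwa [Nat.add_sub_cancel' h, Equiv.apply_symm_apply, Equiv.apply_symm_apply,
      covariance_comm] at this

/-- Bounds the variance of a weighted sum. For each i the at most 2L + 1 near indices j cost at most
Λ C each, and every far index costs ε C times its weight. Nearness is measured after the injection
`a`, so the mixing order need not be the order of summation. -/
theorem sum_mul_mul_le {p : ℕ} {lam : Fin p → ℝ} {Λ : ℝ} (h0 : ∀ i, 0 ≤ lam i)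
    (hΛ : ∀ i, lam i ≤ Λ) {a : Fin p → ℕ} (ha : Function.Injective a) {c : Fin p → Fin p → ℝ}
    {C ε : ℝ} {L : ℕ} (hC : 0 ≤ C) (hε : 0 ≤ ε) (hc : ∀ i j, |c i j| ≤ C)
    (hc' : ∀ i j, L ≤ Nat.dist (a i) (a j) → |c i j| ≤ ε * C) :
    ∑ i, ∑ j, lam i * lam j * c i j ≤
      C * (∑ i, lam i) * ((2 * L + 1) * Λ + ε * ∑ i, lam i) := by
  rw [mul_comm C, mul_assoc, Finset.sum_mul]
  refine Finset.sum_le_sum fun i _ => ?_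
  have hΛ0 : 0 ≤ Λ := (h0 i).trans (hΛ i)
  simp only [mul_assoc, ← Finset.mul_sum]
  refine mul_le_mul_of_nonneg_left ?_ (h0 i)
  have h1 : ∀ j, lam j * c i j ≤
      (if Nat.dist (a i) (a j) < L then Λ * C else 0) + ε * C * lam j := by
    intro j
    have h2 := le_abs_self (c i j)
    split_ifs with h
    · have : lam j * c i j ≤ Λ * C :=
        (mul_le_mul_of_nonneg_left (h2.trans (hc i j)) (h0 j)).trans
          (mul_le_mul_of_nonneg_right (hΛ j) hC)
      have : 0 ≤ ε * C * lam j := by have := h0 j; positivity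
      linarith
    · have := mul_le_mul_of_nonneg_left (h2.trans (hc' i j (not_lt.1 h))) (h0 j)
      linarith
  refine (Finset.sum_le_sum fun j _ => h1 j).trans ?_
  rw [Finset.sum_add_distrib, ← Finset.mul_sum, ← Finset.sum_filter, Finset.sum_const,
    nsmul_eq_mul]
  -- `a` maps the near indices injectively into an interval of at most 2L + 1 integers around a i.
  have hcard : (Finset.univ.filter fun j => Nat.dist (a i) (a j) < L).card ≤ 2 * L + 1 := by
    have h3 : (Finset.univ.filter fun j => Nat.dist (a i) (a j) < L).card ≤
        (Finset.Icc (a i - L) (a i + L)).card := by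
      refine Finset.card_le_card_of_injOn a ?_ ha.injOn
      intro j hj
      simp only [Finset.coe_filter, Finset.mem_univ, true_and, Set.mem_ofPred_eq] at hj
      rw [Finset.coe_Icc, Set.mem_Icc]
      rw [Nat.dist] at hj
      omega
    rw [Nat.card_Icc] at h3
    omega
  have hcard' : ((Finset.univ.filter fun j => Nat.dist (a i) (a j) < L).card : ℝ) ≤ 2 * L + 1 := by
    exact_mod_cast hcard
  have := mul_le_mul_of_nonneg_right hcard' (mul_nonneg hΛ0 hC)
  linarith

end Mixing

/-! ### Limits for the deviations from the class means. -/

section BaseLimits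

/-- The deviation of an observation from the mean of its class. -/
noncomputable def resid {Ω : Type*} (pop : Population) {n : Fin 2 → ℕ}
    (X : (p : ℕ) → (k : Fin 2) → Fin (n k) ⊕ ℕ → Ω → E p) (p : ℕ)
    (s : Σ k : Fin 2, Fin (n k) ⊕ ℕ) (ω : Ω) : E p :=
  X p s.1 s.2 ω - pop.mean s.1 p

variable {Ω : Type*} [MeasurableSpace Ω] {P : Measure Ω}
  {pop : Population} {n : Fin 2 → ℕ} {X : (p : ℕ) → (k : Fin 2) → Fin (n k) ⊕ ℕ → Ω → E p}
  {z : (k : Fin 2) → Fin (n k) ⊕ ℕ → ℕ → Ω → ℝ}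

theorem IsObservationModel.norm_resid_sq_eq_sum (hobs : IsObservationModel P pop n X z)
    {τSq : Fin 2 → ℝ} (hcov : pop.SpikedCovariances τSq) {p : ℕ} (hp : 1 ≤ p)
    (s : Σ k : Fin 2, Fin (n k) ⊕ ℕ) (ω : Ω) :
    ‖resid pop X p s ω‖ ^ 2 = ∑ i : Fin p, pop.eigval s.1 p i * z s.1 s.2 i ω ^ 2 := by
  rw [← (pop.eigvec s.1 p).sum_sq_norm_inner_right]
  refine Finset.sum_congr rfl fun i _ => ?_
  have h := hcov.eigval_pos s.1 hp i
  rw [hobs.score_eq, mul_pow, inv_pow, Real.sq_sqrt h.le, mul_inv_cancel_left₀ h.ne',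
    Real.norm_eq_abs, sq_abs, resid]

variable [IsProbabilityMeasure P]

theorem IsObservationModel.memLp_inner_resid (hobs : IsObservationModel P pop n X z) (p : ℕ)
    (s : Σ k : Fin 2, Fin (n k) ⊕ ℕ) (a : E p) :
    MemLp (fun ω => ⟪a, resid pop X p s ω⟫_ℝ) 2 P :=
  ((hobs.memLp p s.1 s.2).sub (memLp_const _)).const_inner a

theorem IsObservationModel.integral_inner_mul_inner (hobs : IsObservationModel P pop n X z)
    (p : ℕ) (s : Σ k : Fin 2, Fin (n k) ⊕ ℕ) (a b : E p) :
    ∫ ω, ⟪a, resid pop X p s ω⟫_ℝ * ⟪b, resid pop X p s ω⟫_ℝ ∂P =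
      ⟪a, pop.covMap s.1 p b⟫_ℝ := by
  have hint : Integrable (X p s.1 s.2) P := (hobs.memLp p s.1 s.2).integrable (by norm_num)
  rw [← hobs.cov_eq p s.1 s.2 a b, covariance]
  refine integral_congr_ae (Eventually.of_forall fun ω => ?_)
  simp only [resid, inner_sub_right]
  rw [integral_inner hint, integral_inner hint, hobs.mean_eq]

/-- The trace of the covariance does not depend on the basis. It is needed in the eigenbasis of the
other class when two deviations are compared. -/
theorem IsObservationModel.integral_norm_resid_sq (hobs : IsObservationModel P pop n X z)
    (p : ℕ) (s : Σ k : Fin 2, Fin (n k) ⊕ ℕ) (u : OrthonormalBasis (Fin p) ℝ (E p)) :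
    ∑ i, ∫ ω, ⟪u i, resid pop X p s ω⟫_ℝ ^ 2 ∂P = ∑ i : Fin p, pop.eigval s.1 p i := by
  have key : ∀ u : OrthonormalBasis (Fin p) ℝ (E p),
      ∑ i, ∫ ω, ⟪u i, resid pop X p s ω⟫_ℝ ^ 2 ∂P = ∫ ω, ‖resid pop X p s ω‖ ^ 2 ∂P := by
    intro u
    rw [← integral_finsetSum _ fun i _ => (hobs.memLp_inner_resid p s (u i)).integrable_sq]
    refine integral_congr_ae (Eventually.of_forall fun ω => ?_)
    simp only
    rw [← u.sum_sq_norm_inner_right]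
    simp
  rw [key u, ← key (pop.eigvec s.1 p)]
  refine Finset.sum_congr rfl fun i _ => ?_
  simp only [sq]
  rw [hobs.integral_inner_mul_inner, Population.inner_eigvec_covMap, if_pos rfl]

/-- Deviations are asymptotically orthogonal to the mean difference. -/
theorem IsObservationModel.tendsto_inner_resid_meanGap (hobs : IsObservationModel P pop n X z)
    {τSq : Fin 2 → ℝ} (hcov : pop.SpikedCovariances τSq) (hweak : ∀ k, pop.spikeExp k < 1)
    {δ : ℝ} (hmean : pop.MeanGapAsymptotics δ) (s : Σ k : Fin 2, Fin (n k) ⊕ ℕ) :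
    Tendsto (fun q : ℕ × Ω => (q.1 : ℝ)⁻¹ * ⟪pop.meanGap q.1, resid pop X q.1 s q.2⟫_ℝ)
      (probFilter P) (𝓝 0) := by
  obtain ⟨Λ, hΛ, hlim⟩ := hcov.exists_eigval_le s.1 (hweak s.1)
  -- The second moment is p⁻² μᵀ Σ μ ≤ (Λ / p) (‖μ‖ / √p)².
  have hlim2 := hlim.mul (hmean.2.pow 2)
  rw [zero_mul] at hlim2
  refine tendsto_probFilter_of_integral_sq
    (f := fun p ω => (p : ℝ)⁻¹ * ⟪pop.meanGap p, resid pop X p s ω⟫_ℝ) (fun p => ?_) ?_ hlim2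
  · exact ((hobs.memLp_inner_resid p s _).const_mul _).integrable_sq
  · filter_upwards [eventually_ge_atTop 1] with p hp
    have hp' : (0 : ℝ) < p := by exact_mod_cast hp
    simp only [mul_pow]
    rw [integral_const_mul]
    simp only [sq ⟪_, _⟫_ℝ]
    rw [hobs.integral_inner_mul_inner, inv_pow √_, Real.sq_sqrt hp'.le]
    have := mul_le_mul_of_nonneg_left
      (Population.inner_covMap_self_le (k := s.1) (hΛ p hp ·) (pop.meanGap p))
      (by positivity : 0 ≤ (p : ℝ)⁻¹ ^ 2)
    refine this.trans (le_of_eq ?_)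
    ring

/-- Deviations of different observations are asymptotically orthogonal. -/
theorem IsObservationModel.tendsto_inner_resid_resid (hobs : IsObservationModel P pop n X z)
    {τSq : Fin 2 → ℝ} (hcov : pop.SpikedCovariances τSq) (hweak : ∀ k, pop.spikeExp k < 1)
    {s t : Σ k : Fin 2, Fin (n k) ⊕ ℕ} (hst : s ≠ t) :
    Tendsto (fun q : ℕ × Ω => (q.1 : ℝ)⁻¹ * ⟪resid pop X q.1 s q.2, resid pop X q.1 t q.2⟫_ℝ)
      (probFilter P) (𝓝 0) := by
  obtain ⟨Λ, hΛ, hlim⟩ := hcov.exists_eigval_le s.1 (hweak s.1)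
  -- The second moment of the inner product is tr(Σ_s Σ_t) ≤ Λ_s tr Σ_t. In the eigenbasis of the
  -- class of s, independence leaves only the diagonal terms of the double sum.
  have hlim2 := hlim.mul (hcov.tendsto_average_eigval t.1 (hweak t.1))
  rw [zero_mul] at hlim2
  have hind : ∀ p (i j : Fin p), IndepFun
      (fun ω => ⟪pop.eigvec s.1 p i, resid pop X p s ω⟫_ℝ *
        ⟪pop.eigvec s.1 p j, resid pop X p s ω⟫_ℝ)
      (fun ω => ⟪pop.eigvec s.1 p i, resid pop X p t ω⟫_ℝ *
        ⟪pop.eigvec s.1 p j, resid pop X p t ω⟫_ℝ) P := fun p i j =>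
    ((hobs.indep p).indepFun hst).comp
      (φ := fun v => ⟪pop.eigvec s.1 p i, v - pop.mean s.1 p⟫_ℝ *
        ⟪pop.eigvec s.1 p j, v - pop.mean s.1 p⟫_ℝ)
      (ψ := fun v => ⟪pop.eigvec s.1 p i, v - pop.mean t.1 p⟫_ℝ *
        ⟪pop.eigvec s.1 p j, v - pop.mean t.1 p⟫_ℝ) (by fun_prop) (by fun_prop)
  have hint : ∀ p (r : Σ k : Fin 2, Fin (n k) ⊕ ℕ) (i j : Fin p), Integrable
      (fun ω => ⟪pop.eigvec s.1 p i, resid pop X p r ω⟫_ℝ *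
        ⟪pop.eigvec s.1 p j, resid pop X p r ω⟫_ℝ) P := fun p r i j =>
    (hobs.memLp_inner_resid p r _).integrable_mul (hobs.memLp_inner_resid p r _)
  have hint2 : ∀ p (i j : Fin p), Integrable
      (fun ω => (⟪pop.eigvec s.1 p i, resid pop X p s ω⟫_ℝ *
        ⟪pop.eigvec s.1 p j, resid pop X p s ω⟫_ℝ) *
        (⟪pop.eigvec s.1 p i, resid pop X p t ω⟫_ℝ *
        ⟪pop.eigvec s.1 p j, resid pop X p t ω⟫_ℝ)) P := fun p i j =>
    (hind p i j).integrable_mul (hint p s i j) (hint p t i j)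
  have hexp : ∀ (p : ℕ) ω, ((p : ℝ)⁻¹ * ⟪resid pop X p s ω, resid pop X p t ω⟫_ℝ) ^ 2 =
      (p : ℝ)⁻¹ ^ 2 * ∑ i, ∑ j, (⟪pop.eigvec s.1 p i, resid pop X p s ω⟫_ℝ *
        ⟪pop.eigvec s.1 p j, resid pop X p s ω⟫_ℝ) *
        (⟪pop.eigvec s.1 p i, resid pop X p t ω⟫_ℝ *
        ⟪pop.eigvec s.1 p j, resid pop X p t ω⟫_ℝ) := by
    intro p ω
    rw [mul_pow, ← (pop.eigvec s.1 p).sum_inner_mul_inner, sq (∑ i, _), Finset.sum_mul_sum]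
    congr 1
    refine Finset.sum_congr rfl fun i _ => Finset.sum_congr rfl fun j _ => ?_
    rw [real_inner_comm, real_inner_comm (pop.eigvec s.1 p j)]
    ring
  refine tendsto_probFilter_of_integral_sq
    (f := fun p ω => (p : ℝ)⁻¹ * ⟪resid pop X p s ω, resid pop X p t ω⟫_ℝ) (fun p => ?_) ?_ hlim2
  · simp only [hexp]
    exact (integrable_finsetSum _ fun i _ => integrable_finsetSum _ fun j _ =>
      hint2 p i j).const_mul _
  · filter_upwards [eventually_ge_atTop 1] with p hp
    have hp' : (0 : ℝ) < p := by exact_mod_cast hp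
    have h1 : ∀ i j : Fin p, ∫ ω, (⟪pop.eigvec s.1 p i, resid pop X p s ω⟫_ℝ *
        ⟪pop.eigvec s.1 p j, resid pop X p s ω⟫_ℝ) *
        (⟪pop.eigvec s.1 p i, resid pop X p t ω⟫_ℝ *
        ⟪pop.eigvec s.1 p j, resid pop X p t ω⟫_ℝ) ∂P = (if i = j then pop.eigval s.1 p i else 0) *
        ∫ ω, ⟪pop.eigvec s.1 p i, resid pop X p t ω⟫_ℝ *
        ⟪pop.eigvec s.1 p j, resid pop X p t ω⟫_ℝ ∂P := by
      intro i j
      rw [(hind p i j).integral_fun_mul_eq_mul_integral (hint p s i j).aestronglyMeasurable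
        (hint p t i j).aestronglyMeasurable, hobs.integral_inner_mul_inner,
        Population.inner_eigvec_covMap]
    simp only [hexp]
    rw [integral_const_mul, integral_finsetSum _ fun i _ => integrable_finsetSum _ fun j _ =>
      hint2 p i j]
    have h2 : ∀ i : Fin p, ∫ ω, ∑ j, (⟪pop.eigvec s.1 p i, resid pop X p s ω⟫_ℝ *
        ⟪pop.eigvec s.1 p j, resid pop X p s ω⟫_ℝ) *
        (⟪pop.eigvec s.1 p i, resid pop X p t ω⟫_ℝ *
        ⟪pop.eigvec s.1 p j, resid pop X p t ω⟫_ℝ) ∂P =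
        pop.eigval s.1 p i * ∫ ω, ⟪pop.eigvec s.1 p i, resid pop X p t ω⟫_ℝ ^ 2 ∂P := by
      intro i
      rw [integral_finsetSum _ fun j _ => hint2 p i j]
      simp only [h1, ite_mul, zero_mul, Finset.sum_ite_eq, Finset.mem_univ, if_true, sq]
    simp only [h2]
    have h3 : ∑ i : Fin p, pop.eigval s.1 p i *
        ∫ ω, ⟪pop.eigvec s.1 p i, resid pop X p t ω⟫_ℝ ^ 2 ∂P ≤
        Λ p * ∑ i : Fin p, pop.eigval t.1 p i := by
      rw [← hobs.integral_norm_resid_sq p t (pop.eigvec s.1 p), Finset.mul_sum]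
      exact Finset.sum_le_sum fun i _ => mul_le_mul_of_nonneg_right (hΛ p hp i)
        (integral_nonneg fun ω => sq_nonneg _)
    refine (mul_le_mul_of_nonneg_left h3 (by positivity)).trans (le_of_eq ?_)
    ring

/-- The law of large numbers for squared lengths. -/
theorem IsObservationModel.tendsto_norm_resid_sq (hobs : IsObservationModel P pop n X z)
    {τSq : Fin 2 → ℝ} (hcov : pop.SpikedCovariances τSq) (hweak : ∀ k, pop.spikeExp k < 1)
    (s : Σ k : Fin 2, Fin (n k) ⊕ ℕ) :
    Tendsto (fun q : ℕ × Ω => (q.1 : ℝ)⁻¹ * ‖resid pop X q.1 s q.2‖ ^ 2)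
      (probFilter P) (𝓝 (τSq s.1)) := by
  obtain ⟨Λ, hΛ, hlim⟩ := hcov.exists_eigval_le s.1 (hweak s.1)
  have havg := hcov.tendsto_average_eigval s.1 (hweak s.1)
  obtain ⟨C, hC⟩ := hobs.fourth_moments
  have hL : ∀ i, MemLp (fun ω => z s.1 s.2 i ω ^ 2) 2 P := by
    intro i
    have h4 := (hC s.1 s.2 i).1
    refine (memLp_two_iff_integrable_sq (h4.aestronglyMeasurable.pow 2)).2 ?_
    refine (MemLp.integrable_norm_pow (p := 4) h4 (by norm_num)).congr
      (Eventually.of_forall fun ω => ?_)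
    simp only [Real.norm_eq_abs, Pi.pow_apply]
    rw [← pow_mul, ← abs_pow, abs_of_nonneg (by positivity)]
  have hV : ∀ i, Var[fun ω => z s.1 s.2 i ω ^ 2; P] ≤ C := by
    intro i
    refine (variance_le_expectation_sq (hL i).aestronglyMeasurable).trans
      (le_trans (le_of_eq ?_) (hC s.1 s.2 i).2)
    refine integral_congr_ae (Eventually.of_forall fun ω => ?_)
    simp only [Pi.pow_apply, ← pow_mul]
  have hC0 : 0 ≤ C := (variance_nonneg _ P).trans (hV 0)
  obtain ⟨π, hπ⟩ := hobs.mixing s.1 s.2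
  have hmean : ∀ p, ∫ ω, ‖resid pop X p s ω‖ ^ 2 ∂P = ∑ i : Fin p, pop.eigval s.1 p i := by
    intro p
    rw [← hobs.integral_norm_resid_sq p s (pop.eigvec s.1 p),
      ← integral_finsetSum _ fun i _ => (hobs.memLp_inner_resid p s _).integrable_sq]
    refine integral_congr_ae (Eventually.of_forall fun ω => ?_)
    simp only
    rw [← (pop.eigvec s.1 p).sum_sq_norm_inner_right]
    simp
  have hmem : ∀ p, 1 ≤ p → MemLp (fun ω => ‖resid pop X p s ω‖ ^ 2) 2 P := by
    intro p hp
    simp only [hobs.norm_resid_sq_eq_sum hcov hp s]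
    exact memLp_finsetSum _ fun i _ => (hL i).const_mul _
  have hvar : ∀ p, 1 ≤ p → ∫ ω, (‖resid pop X p s ω‖ ^ 2 - ∑ i : Fin p, pop.eigval s.1 p i) ^ 2 ∂P
      = ∑ i : Fin p, ∑ j : Fin p, pop.eigval s.1 p i * pop.eigval s.1 p j *
        cov[fun ω => z s.1 s.2 i ω ^ 2, fun ω => z s.1 s.2 j ω ^ 2; P] := by
    intro p hp
    rw [← hmean p, ← variance_eq_integral (hmem p hp).aestronglyMeasurable.aemeasurable]
    simp only [hobs.norm_resid_sq_eq_sum hcov hp s]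
    rw [variance_fun_sum fun i : Fin p => (hL i).const_mul _]
    refine Finset.sum_congr rfl fun i _ => Finset.sum_congr rfl fun j _ => ?_
    rw [covariance_const_mul_left, covariance_const_mul_right, mul_assoc]
  have hzero : Tendsto (fun q : ℕ × Ω => (q.1 : ℝ)⁻¹ *
      (‖resid pop X q.1 s q.2‖ ^ 2 - ∑ i : Fin q.1, pop.eigval s.1 q.1 i)) (probFilter P) (𝓝 0) := by
    refine tendsto_probFilter_of_integral_sq (f := fun p ω => (p : ℝ)⁻¹ *
      (‖resid pop X p s ω‖ ^ 2 - ∑ i : Fin p, pop.eigval s.1 p i)) (fun p => ?_)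
      (Eventually.of_forall fun p => le_rfl) ?_
    · rcases Nat.eq_zero_or_pos p with rfl | hp
      · simp
      · exact (((hmem p hp).sub (memLp_const _)).const_mul _).integrable_sq
    · simp only [mul_pow, integral_const_mul]
      refine tendsto_order.2 ⟨fun a ha => Eventually.of_forall fun p => ha.trans_le ?_,
        fun η hη => ?_⟩
      · exact mul_nonneg (sq_nonneg _) (integral_nonneg fun ω => sq_nonneg _)
      -- For fixed L the variance bound tends to ε C τ⁴, where τ² is `τSq s.1`, because Λ / p → 0.
      -- This ε keeps the limit below η; the summand 1 allows for C = 0.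
      · set ε : ℝ := η / (2 * (C * τSq s.1 ^ 2 + 1)) with hε
        have hε0 : 0 < ε := by positivity
        obtain ⟨L, hLc⟩ := exists_abs_covariance_sq_le hL hV hπ hε0
        have hb := (havg.const_mul C).mul
          ((hlim.const_mul (2 * (L : ℝ) + 1)).add (havg.const_mul ε))
        have hlt : C * τSq s.1 * ((2 * (L : ℝ) + 1) * 0 + ε * τSq s.1) < η := by
          have h1 : C * τSq s.1 * ((2 * (L : ℝ) + 1) * 0 + ε * τSq s.1) =
            η * (C * τSq s.1 ^ 2 / (2 * (C * τSq s.1 ^ 2 + 1))) := by rw [hε]; ring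
          have h2 : C * τSq s.1 ^ 2 / (2 * (C * τSq s.1 ^ 2 + 1)) < 1 := by
            rw [div_lt_one (by positivity)]
            have : 0 ≤ C * τSq s.1 ^ 2 := by positivity
            linarith
          rw [h1]
          exact mul_lt_of_lt_one_right hη h2
        filter_upwards [hb.eventually_lt_const hlt, eventually_ge_atTop 1] with p hp hp1
        refine lt_of_le_of_lt ?_ hp
        rw [hvar p hp1]
        have h3 := sum_mul_mul_le (lam := fun i : Fin p => pop.eigval s.1 p i) (Λ := Λ p)
          (fun i => (hcov.eigval_pos s.1 hp1 i).le) (fun i => hΛ p hp1 i)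
          (a := fun i : Fin p => π.symm i) (π.symm.injective.comp Fin.val_injective)
          (c := fun i j : Fin p => cov[fun ω => z s.1 s.2 i ω ^ 2,
            fun ω => z s.1 s.2 j ω ^ 2; P]) hC0 hε0.le
          (fun i j => abs_covariance_le (hL _) (hL _) (hV _) (hV _))
          (fun i j hij => hLc _ _ hij)
        refine (mul_le_mul_of_nonneg_left h3 (sq_nonneg _)).trans (le_of_eq ?_)
        ring
  have := hzero.add (havg.comp (tendsto_fst_probFilter (P := P)))
  rw [zero_add] at this
  refine this.congr fun q => ?_
  simp only [Function.comp_apply]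
  ring

end BaseLimits

/-! ### Calculus of scaled inner products. -/

section GramLimits

/-- The scaled inner product `p⁻¹ ⟪V, W⟫` converges to `c` in probability. -/
def GramTendsto {Ω : Type*} [MeasurableSpace Ω] (P : Measure Ω) (V W : (q : ℕ × Ω) → E q.1)
    (c : ℝ) : Prop :=
  Tendsto (fun q : ℕ × Ω => (q.1 : ℝ)⁻¹ * ⟪V q, W q⟫_ℝ) (probFilter P) (𝓝 c)

variable {Ω : Type*} [MeasurableSpace Ω] {P : Measure Ω} {V V' W W' : (q : ℕ × Ω) → E q.1}
  {a b c : ℝ}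

theorem GramTendsto.symm (h : GramTendsto P V W c) : GramTendsto P W V c := by
  unfold GramTendsto at *
  simpa only [real_inner_comm] using h

theorem GramTendsto.congr_left (h : GramTendsto P V W c) (hV : ∀ q, V q = V' q) :
    GramTendsto P V' W c := by
  rwa [← funext hV]

theorem GramTendsto.sub_left (h : GramTendsto P V W a) (h' : GramTendsto P V' W b) :
    GramTendsto P (fun q => V q - V' q) W (a - b) := by
  unfold GramTendsto at *
  simpa only [inner_sub_left, mul_sub] using h.sub h'

theorem GramTendsto.smul_left (r : ℝ) (h : GramTendsto P V W a) :
    GramTendsto P (fun q => r • V q) W (r * a) := by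
  unfold GramTendsto at *
  simpa only [real_inner_smul_left, mul_left_comm] using h.const_mul r

theorem GramTendsto.sum_left {ι : Type*} {s : Finset ι} {V : ι → (q : ℕ × Ω) → E q.1} {a : ι → ℝ}
    (h : ∀ i ∈ s, GramTendsto P (V i) W (a i)) :
    GramTendsto P (fun q => ∑ i ∈ s, V i q) W (∑ i ∈ s, a i) := by
  unfold GramTendsto at *
  simpa only [sum_inner, Finset.mul_sum] using tendsto_finsetSum s h

theorem GramTendsto.sub_right (h : GramTendsto P W V a) (h' : GramTendsto P W V' b) :
    GramTendsto P W (fun q => V q - V' q) (a - b) := (h.symm.sub_left h'.symm).symm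

theorem GramTendsto.smul_right (r : ℝ) (h : GramTendsto P W V a) :
    GramTendsto P W (fun q => r • V q) (r * a) := (h.symm.smul_left r).symm

theorem GramTendsto.norm (h : GramTendsto P V V c) :
    Tendsto (fun q : ℕ × Ω => (√(q.1 : ℝ))⁻¹ * ‖V q‖) (probFilter P) (𝓝 √c) := by
  refine ((Real.continuous_sqrt.tendsto c).comp h).congr fun q => ?_
  rw [Function.comp_apply, real_inner_self_eq_norm_sq, Real.sqrt_mul (by positivity),
    Real.sqrt_inv, Real.sqrt_sq (norm_nonneg _)]

end GramLimits

/-! ### Stability of positive definite forms. -/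

section Coercivity

theorem sq_sum_abs_le {ι : Type*} [Fintype ι] (b : ι → ℝ) :
    (∑ i, |b i|) ^ 2 ≤ Fintype.card ι * ∑ i, b i ^ 2 := by
  have := sq_sum_le_card_mul_sum_sq (s := Finset.univ) (f := fun i => |b i|)
  simpa using this

/-- An entrywise perturbation by ε changes the form by at most ε (Σ |b|)², and Cauchy–Schwarz bounds
this by ε times the cardinality times Σ b². -/
theorem coercive_of_close {ι : Type*} [Fintype ι] {g γ : ι → ι → ℝ} {τ ε : ℝ} (hε : 0 ≤ ε)
    (hg : ∀ i j, |g i j - γ i j| ≤ ε) (b : ι → ℝ)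
    (hγ : τ * ∑ i, b i ^ 2 ≤ ∑ i, ∑ j, b i * b j * γ i j) :
    (τ - ε * Fintype.card ι) * ∑ i, b i ^ 2 ≤ ∑ i, ∑ j, b i * b j * g i j := by
  have h1 : ∀ i j, b i * b j * γ i j - ε * (|b i| * |b j|) ≤ b i * b j * g i j := by
    intro i j
    have h2 : |b i * b j * (g i j - γ i j)| ≤ |b i| * |b j| * ε := by
      rw [abs_mul, abs_mul]
      exact mul_le_mul_of_nonneg_left (hg i j) (by positivity)
    have h3 := (abs_le.1 h2).1
    linarith
  have h4 : ∑ i, ∑ j, b i * b j * γ i j - ε * (∑ i, |b i|) ^ 2 ≤ ∑ i, ∑ j, b i * b j * g i j := by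
    rw [sq, Finset.sum_mul_sum, Finset.mul_sum, ← Finset.sum_sub_distrib]
    refine Finset.sum_le_sum fun i _ => ?_
    rw [Finset.mul_sum, ← Finset.sum_sub_distrib]
    exact Finset.sum_le_sum fun j _ => h1 i j
  have h5 := mul_le_mul_of_nonneg_left (sq_sum_abs_le b) hε
  linarith

end Coercivity

/-! ### The limiting Gram matrix and its uniform consequences. -/

section Limits

/-- The limits of the scaled inner products of the observations, centred at the mean of the
second class. -/
noncomputable def gramLimit {n : Fin 2 → ℕ} (δ : ℝ) (τSq : Fin 2 → ℝ)
    (s t : Σ k : Fin 2, Fin (n k) ⊕ ℕ) : ℝ :=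
  (if s = t then τSq s.1 else 0) + (if s.1 = 0 then 1 else 0) * (if t.1 = 0 then 1 else 0) * δ ^ 2

/-- An observation centred at the mean of the second class. -/
noncomputable def shifted {Ω : Type*} (pop : Population) {n : Fin 2 → ℕ}
    (X : (p : ℕ) → (k : Fin 2) → Fin (n k) ⊕ ℕ → Ω → E p)
    (s : Σ k : Fin 2, Fin (n k) ⊕ ℕ) (q : ℕ × Ω) : E q.1 :=
  X q.1 s.1 s.2 q.2 - pop.mean 1 q.1

/-- The data of the theorem: a spiked population with weak spikes and its observations. -/
structure WeakSpikeModel {Ω : Type*} [MeasurableSpace Ω] (P : Measure Ω) (pop : Population)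
    (n : Fin 2 → ℕ) (X : (p : ℕ) → (k : Fin 2) → Fin (n k) ⊕ ℕ → Ω → E p)
    (z : (k : Fin 2) → Fin (n k) ⊕ ℕ → ℕ → Ω → ℝ) (δ : ℝ) (τSq : Fin 2 → ℝ) : Prop where
  one_le : ∀ k, 1 ≤ n k
  meanGap : pop.MeanGapAsymptotics δ
  spiked : pop.SpikedCovariances τSq
  obs : IsObservationModel P pop n X z
  weak : ∀ k, pop.spikeExp k < 1

variable {Ω : Type*} [MeasurableSpace Ω] {P : Measure Ω}
  {pop : Population} {n : Fin 2 → ℕ} {X : (p : ℕ) → (k : Fin 2) → Fin (n k) ⊕ ℕ → Ω → E p}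
  {z : (k : Fin 2) → Fin (n k) ⊕ ℕ → ℕ → Ω → ℝ} {δ : ℝ} {τSq : Fin 2 → ℝ}

/-- A training observation centred at the mean of the second class. -/
noncomputable def shiftedTrain {Ω : Type*} (pop : Population) {n : Fin 2 → ℕ}
    (X : (p : ℕ) → (k : Fin 2) → Fin (n k) ⊕ ℕ → Ω → E p) (k : Fin 2) (j : Fin (n k))
    (q : ℕ × Ω) : E q.1 :=
  shifted pop X ⟨k, Sum.inl j⟩ q

theorem shiftedTrain_eq {Ω : Type*} (X : (p : ℕ) → (k : Fin 2) → Fin (n k) ⊕ ℕ → Ω → E p)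
    (k : Fin 2) (j : Fin (n k)) (q : ℕ × Ω) :
    shiftedTrain pop X k j q = train X q.1 q.2 k j - pop.mean 1 q.1 := rfl

theorem classMean_sub_eq {Ω : Type*} (hn : ∀ k, 1 ≤ n k)
    (X : (p : ℕ) → (k : Fin 2) → Fin (n k) ⊕ ℕ → Ω → E p) (k : Fin 2) (q : ℕ × Ω) :
    classMean (train X q.1 q.2) k - pop.mean 1 q.1 =
      (n k : ℝ)⁻¹ • ∑ j, shiftedTrain pop X k j q := by
  have hk : (n k : ℝ) ≠ 0 := by have := hn k; positivity
  simp only [shiftedTrain_eq, Finset.sum_sub_distrib, smul_sub, classMean]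
  simp [← Nat.cast_smul_eq_nsmul ℝ, smul_smul, hk]

theorem totalMean_sub_eq {Ω : Type*} (hn : ∀ k, 1 ≤ n k)
    (X : (p : ℕ) → (k : Fin 2) → Fin (n k) ⊕ ℕ → Ω → E p) (q : ℕ × Ω) :
    totalMean (train X q.1 q.2) - pop.mean 1 q.1 =
      ((n 0 : ℝ) + n 1)⁻¹ • ∑ k, ∑ j, shiftedTrain pop X k j q := by
  have hN : ((n 0 : ℝ) + n 1) ≠ 0 := by have := hn 0; positivity
  simp only [shiftedTrain_eq, Finset.sum_sub_distrib, smul_sub, totalMean]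
  simp [← Nat.cast_smul_eq_nsmul ℝ, ← add_smul, smul_smul, hN]

theorem meanDiff_eq {Ω : Type*} (hn : ∀ k, 1 ≤ n k)
    (X : (p : ℕ) → (k : Fin 2) → Fin (n k) ⊕ ℕ → Ω → E p) (q : ℕ × Ω) :
    meanDiff (train X q.1 q.2) = (n 0 : ℝ)⁻¹ • ∑ j, shiftedTrain pop X 0 j q -
      (n 1 : ℝ)⁻¹ • ∑ j, shiftedTrain pop X 1 j q := by
  rw [← classMean_sub_eq hn, ← classMean_sub_eq hn, meanDiff, sub_sub_sub_cancel_right]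

theorem WeakSpikeModel.gramTendsto_classMean (h : WeakSpikeModel P pop n X z δ τSq)
    {V : (q : ℕ × Ω) → E q.1} {k : Fin 2} {c : ℝ}
    (hV : ∀ j : Fin (n k), GramTendsto P (shiftedTrain pop X k j) V c) :
    GramTendsto P (fun q => classMean (train X q.1 q.2) k - pop.mean 1 q.1) V c := by
  have h0 : (n k : ℝ) ≠ 0 := by have := h.one_le k; positivity
  simp only [classMean_sub_eq h.one_le]
  convert (GramTendsto.sum_left (s := Finset.univ) fun j _ => hV j).smul_left (n k : ℝ)⁻¹ using 1
  simp [h0]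

theorem WeakSpikeModel.gramTendsto_totalMean (h : WeakSpikeModel P pop n X z δ τSq)
    {V : (q : ℕ × Ω) → E q.1} {c : Fin 2 → ℝ}
    (hV : ∀ k (j : Fin (n k)), GramTendsto P (shiftedTrain pop X k j) V (c k)) :
    GramTendsto P (fun q => totalMean (train X q.1 q.2) - pop.mean 1 q.1) V
      (((n 0 : ℝ) + n 1)⁻¹ * (n 0 * c 0 + n 1 * c 1)) := by
  simp only [totalMean_sub_eq h.one_le]
  convert (GramTendsto.sum_left (s := Finset.univ) fun k _ =>
    GramTendsto.sum_left (s := Finset.univ) fun j _ => hV k j).smul_left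
      ((n 0 : ℝ) + n 1)⁻¹ using 1
  simp

/-- A limit common to both classes passes unchanged to the average, so centring at the total mean
cancels it. -/
theorem WeakSpikeModel.gramTendsto_sub_totalMean (h : WeakSpikeModel P pop n X z δ τSq)
    {V : (q : ℕ × Ω) → E q.1} {c : ℝ}
    (hV : ∀ k (j : Fin (n k)), GramTendsto P (shiftedTrain pop X k j) V c)
    (k : Fin 2) (j : Fin (n k)) :
    GramTendsto P (fun q => train X q.1 q.2 k j - totalMean (train X q.1 q.2)) V 0 := by
  have hN : ((n 0 : ℝ) + n 1) ≠ 0 := by have := h.one_le 0; positivity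
  have h1 := (hV k j).sub_left (h.gramTendsto_totalMean (c := fun _ => c) hV)
  simp only [shiftedTrain_eq, sub_sub_sub_cancel_right] at h1
  convert h1 using 1
  field_simp
  ring

variable [IsProbabilityMeasure P]

/-- A shifted observation is its deviation, plus the mean gap for the first class. The cross terms
vanish in the limit, which leaves the squared length of a deviation and δ². -/
theorem WeakSpikeModel.gramTendsto_shifted (h : WeakSpikeModel P pop n X z δ τSq)
    (s t : Σ k : Fin 2, Fin (n k) ⊕ ℕ) :
    GramTendsto P (shifted pop X s) (shifted pop X t) (gramLimit δ τSq s t) := by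
  have h1 : Tendsto (fun q : ℕ × Ω => (q.1 : ℝ)⁻¹ *
      ⟪resid pop X q.1 s q.2, resid pop X q.1 t q.2⟫_ℝ) (probFilter P)
      (𝓝 (if s = t then τSq s.1 else 0)) := by
    split_ifs with hst
    · subst hst
      simpa only [real_inner_self_eq_norm_sq] using h.obs.tendsto_norm_resid_sq h.spiked h.weak s
    · exact h.obs.tendsto_inner_resid_resid h.spiked h.weak hst
  have h2 := h.obs.tendsto_inner_resid_meanGap h.spiked h.weak h.meanGap
  have h3 : Tendsto (fun q : ℕ × Ω => (q.1 : ℝ)⁻¹ * ⟪pop.meanGap q.1, pop.meanGap q.1⟫_ℝ)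
      (probFilter P) (𝓝 (δ ^ 2)) := by
    refine ((h.meanGap.2.pow 2).comp tendsto_fst_probFilter).congr fun q => ?_
    simp only [Function.comp_apply]
    rw [mul_pow, inv_pow, Real.sq_sqrt (by positivity), real_inner_self_eq_norm_sq]
  have h4 : ∀ (s : Σ k : Fin 2, Fin (n k) ⊕ ℕ) (q : ℕ × Ω), shifted pop X s q =
      resid pop X q.1 s q.2 + (if s.1 = 0 then 1 else 0 : ℝ) • pop.meanGap q.1 := by
    rintro ⟨k, o⟩ q
    fin_cases k <;> simp [shifted, resid, Population.meanGap]
  have h5 := ((h1.add ((h2 t).const_mul (if s.1 = 0 then 1 else 0 : ℝ))).add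
    ((h2 s).const_mul (if t.1 = 0 then 1 else 0 : ℝ))).add
    (h3.const_mul ((if s.1 = 0 then 1 else 0) * (if t.1 = 0 then 1 else 0) : ℝ))
  rw [mul_zero, mul_zero, add_zero, add_zero] at h5
  refine h5.congr fun q => ?_
  rw [h4, h4]
  simp only [inner_add_left, inner_add_right, real_inner_smul_left, real_inner_smul_right]
  rw [real_inner_comm (pop.meanGap q.1) (resid pop X q.1 s q.2)]
  ring

theorem WeakSpikeModel.gramTendsto_meanDiff (h : WeakSpikeModel P pop n X z δ τSq)
    (s : Σ k : Fin 2, Fin (n k) ⊕ ℕ) :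
    GramTendsto P (shifted pop X s) (fun q => meanDiff (train X q.1 q.2))
      ((n 0 : ℝ)⁻¹ * ∑ j, gramLimit δ τSq s ⟨0, Sum.inl j⟩ -
        (n 1 : ℝ)⁻¹ * ∑ j, gramLimit δ τSq s ⟨1, Sum.inl j⟩) := by
  simp only [meanDiff_eq (pop := pop) h.one_le]
  exact ((GramTendsto.sum_left fun j _ => (h.gramTendsto_shifted s _).symm).symm.smul_right
    _).sub_right ((GramTendsto.sum_left fun j _ =>
      (h.gramTendsto_shifted s _).symm).symm.smul_right _)

theorem WeakSpikeModel.gramTendsto_test_meanDiff (h : WeakSpikeModel P pop n X z δ τSq)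
    (k : Fin 2) (l : ℕ) :
    GramTendsto P (shifted pop X ⟨k, Sum.inr l⟩) (fun q => meanDiff (train X q.1 q.2))
      (if k = 0 then δ ^ 2 else 0) := by
  have h0 : (n 0 : ℝ) ≠ 0 := by have := h.one_le 0; positivity
  convert h.gramTendsto_meanDiff ⟨k, Sum.inr l⟩ using 1
  fin_cases k <;> simp [gramLimit, h0]

/-- The limit of the scaled inner product of a centred training observation with the mean
difference. -/
noncomputable def diffLimit (n : Fin 2 → ℕ) (δ : ℝ) (τSq : Fin 2 → ℝ) (k : Fin 2) : ℝ :=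
  if k = 0 then τSq 0 / n 0 + δ ^ 2 else -(τSq 1 / n 1)

theorem WeakSpikeModel.gramTendsto_train_meanDiff (h : WeakSpikeModel P pop n X z δ τSq)
    (k : Fin 2) (j : Fin (n k)) :
    GramTendsto P (shiftedTrain pop X k j) (fun q => meanDiff (train X q.1 q.2))
      (diffLimit n δ τSq k) := by
  have h0 : (n 0 : ℝ) ≠ 0 := by have := h.one_le 0; positivity
  have h1 : (n 1 : ℝ) ≠ 0 := by have := h.one_le 1; positivity
  have e : diffLimit n δ τSq k = (n 0 : ℝ)⁻¹ * ∑ i, gramLimit δ τSq ⟨k, Sum.inl j⟩ ⟨0, Sum.inl i⟩ -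
      (n 1 : ℝ)⁻¹ * ∑ i, gramLimit δ τSq ⟨k, Sum.inl j⟩ ⟨1, Sum.inl i⟩ := by
    fin_cases k
    · simp [gramLimit, diffLimit, Finset.sum_add_distrib]
      field_simp
    · simp [gramLimit, diffLimit]
      field_simp
  rw [e]
  exact h.gramTendsto_meanDiff ⟨k, Sum.inl j⟩

theorem WeakSpikeModel.gramTendsto_meanDiff_self (h : WeakSpikeModel P pop n X z δ τSq) :
    GramTendsto P (fun q => meanDiff (train X q.1 q.2)) (fun q => meanDiff (train X q.1 q.2))
      (δ ^ 2 + τSq 0 / n 0 + τSq 1 / n 1) := by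
  have h1 := (h.gramTendsto_classMean (h.gramTendsto_train_meanDiff 0)).sub_left
    (h.gramTendsto_classMean (h.gramTendsto_train_meanDiff 1))
  simp only [sub_sub_sub_cancel_right] at h1
  have e : δ ^ 2 + τSq 0 / n 0 + τSq 1 / n 1 = diffLimit n δ τSq 0 - diffLimit n δ τSq 1 := by
    simp [diffLimit]
    ring
  rw [e]
  exact h1

theorem WeakSpikeModel.gramTendsto_test_sub_totalMean (h : WeakSpikeModel P pop n X z δ τSq)
    (k : Fin 2) (l : ℕ) :
    GramTendsto P (fun q => test X q.1 k l q.2 - totalMean (train X q.1 q.2))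
      (fun q => meanDiff (train X q.1 q.2))
      ((if k = 0 then n 1 / ((n 0 : ℝ) + n 1) else -(n 0 / ((n 0 : ℝ) + n 1))) * δ ^ 2 -
        (τSq 0 - τSq 1) / ((n 0 : ℝ) + n 1)) := by
  have h0 : (n 0 : ℝ) ≠ 0 := by have := h.one_le 0; positivity
  have h1 : (n 1 : ℝ) ≠ 0 := by have := h.one_le 1; positivity
  have hN : ((n 0 : ℝ) + n 1) ≠ 0 := by have := h.one_le 0; positivity
  have h2 := (h.gramTendsto_test_meanDiff k l).sub_left
    (h.gramTendsto_totalMean h.gramTendsto_train_meanDiff)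
  simp only [shifted, sub_sub_sub_cancel_right] at h2
  have e : (if k = 0 then n 1 / ((n 0 : ℝ) + n 1) else -(n 0 / ((n 0 : ℝ) + n 1))) * δ ^ 2 -
      (τSq 0 - τSq 1) / ((n 0 : ℝ) + n 1) = (if k = 0 then δ ^ 2 else 0) -
      ((n 0 : ℝ) + n 1)⁻¹ * (n 0 * diffLimit n δ τSq 0 + n 1 * diffLimit n δ τSq 1) := by
    fin_cases k
    · simp [diffLimit]
      field_simp
      ring
    · simp [diffLimit]
      field_simp
      ring
  rw [e]
  exact h2

/-- The value is irrelevant: only the boundedness of the length at scale √p is used, in a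
Cauchy–Schwarz estimate. The centring is expanded in one argument at a time. -/
theorem WeakSpikeModel.exists_gramTendsto_test_sub_totalMean
    (h : WeakSpikeModel P pop n X z δ τSq) (k : Fin 2) (l : ℕ) :
    ∃ c, GramTendsto P (fun q => test X q.1 k l q.2 - totalMean (train X q.1 q.2))
      (fun q => test X q.1 k l q.2 - totalMean (train X q.1 q.2)) c := by
  have key : ∀ (W : (q : ℕ × Ω) → E q.1) (c : (Σ k : Fin 2, Fin (n k) ⊕ ℕ) → ℝ),
      (∀ s, GramTendsto P (shifted pop X s) W (c s)) →
      ∃ a, GramTendsto P (fun q => test X q.1 k l q.2 - totalMean (train X q.1 q.2)) W a := by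
    intro W c hc
    refine ⟨_, ((hc ⟨k, Sum.inr l⟩).sub_left
      ((GramTendsto.sum_left (s := Finset.univ) fun k _ =>
        GramTendsto.sum_left (s := Finset.univ) fun j _ =>
          hc ⟨k, Sum.inl j⟩).smul_left ((n 0 : ℝ) + n 1)⁻¹)).congr_left fun q => ?_⟩
    exact (congrArg (_ - ·) (totalMean_sub_eq h.one_le X q).symm).trans
      (sub_sub_sub_cancel_right _ _ _)
  have h1 : ∀ s : Σ k : Fin 2, Fin (n k) ⊕ ℕ, ∃ c, GramTendsto P (shifted pop X s)
      (fun q => test X q.1 k l q.2 - totalMean (train X q.1 q.2)) c := by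
    intro s
    obtain ⟨c, hc⟩ := key _ _ fun t => h.gramTendsto_shifted t s
    exact ⟨c, hc.symm⟩
  choose c hc using h1
  exact key _ c hc

/-- The limit against d depends only on the class, so it cancels within a class. This is why d is
asymptotically orthogonal to the range of S_W. -/
theorem WeakSpikeModel.gramTendsto_sub_classMean (h : WeakSpikeModel P pop n X z δ τSq)
    (k : Fin 2) (j : Fin (n k)) :
    GramTendsto P (fun q => train X q.1 q.2 k j - classMean (train X q.1 q.2) k)
      (fun q => meanDiff (train X q.1 q.2)) 0 := by
  have h1 := (h.gramTendsto_train_meanDiff k j).sub_left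
    (h.gramTendsto_classMean (h.gramTendsto_train_meanDiff k))
  simpa only [shiftedTrain_eq, sub_sub_sub_cancel_right, sub_self] using h1

/-- Linear combinations of the training observations with coefficients of sum zero are
uniformly of length at least of order `√p`. -/
theorem WeakSpikeModel.exists_coercive (h : WeakSpikeModel P pop n X z δ τSq) :
    ∃ c > 0, ∀ᶠ q in probFilter P, ∀ b, ∑ k, classSum n b k = 0 →
      c * q.1 * ∑ k, ∑ j, b k j ^ 2 ≤ ‖combo (train X q.1 q.2) b‖ ^ 2 := by
  set τ : ℝ := min (τSq 0) (τSq 1) with hτ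
  have hτ0 : 0 < τ := lt_min (h.spiked.limit_pos 0) (h.spiked.limit_pos 1)
  have hτk : ∀ k, τ ≤ τSq k := by
    intro k
    fin_cases k
    · exact min_le_left _ _
    · exact min_le_right _ _
  set T := Σ k : Fin 2, Fin (n k)
  have hT : (0 : ℝ) < Fintype.card T := by
    have : Nonempty T := ⟨⟨0, ⟨0, h.one_le 0⟩⟩⟩
    exact_mod_cast Fintype.card_pos
  -- This tolerance costs half of the constant τ of the limit form.
  set ε : ℝ := τ / (2 * Fintype.card T) with hε
  have hε0 : 0 < ε := by positivity
  have hev : ∀ᶠ q in probFilter P, ∀ s t : T, |(q.1 : ℝ)⁻¹ * ⟪shiftedTrain pop X s.1 s.2 q,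
      shiftedTrain pop X t.1 t.2 q⟫_ℝ -
        gramLimit (n := n) δ τSq ⟨s.1, Sum.inl s.2⟩ ⟨t.1, Sum.inl t.2⟩| ≤ ε := by
    rw [eventually_all]
    intro s
    rw [eventually_all]
    intro t
    filter_upwards [Metric.tendsto_nhds.1
      (h.gramTendsto_shifted ⟨s.1, Sum.inl s.2⟩ ⟨t.1, Sum.inl t.2⟩) ε hε0] with q hq using hq.le
  have hp1 := (tendsto_fst_probFilter (P := P)).eventually (eventually_ge_atTop 1)
  refine ⟨τ / 2, by positivity, ?_⟩
  filter_upwards [hev, hp1] with q hq hp b hb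
  have hp' : (0 : ℝ) < q.1 := by exact_mod_cast hp
  -- The limit form is a diagonal with entries at least τ plus δ² times a square.
  have hγ : τ * ∑ s : T, b s.1 s.2 ^ 2 ≤ ∑ s : T, ∑ t : T, b s.1 s.2 * b t.1 t.2 *
      gramLimit (n := n) δ τSq ⟨s.1, Sum.inl s.2⟩ ⟨t.1, Sum.inl t.2⟩ := by
    have h1 : ∑ s : T, ∑ t : T, b s.1 s.2 * b t.1 t.2 *
        gramLimit (n := n) δ τSq ⟨s.1, Sum.inl s.2⟩ ⟨t.1, Sum.inl t.2⟩ =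
        ∑ s : T, τSq s.1 * b s.1 s.2 ^ 2 +
          δ ^ 2 * (∑ s : T, b s.1 s.2 * (if s.1 = 0 then 1 else 0)) ^ 2 := by
      rw [sq (∑ s : T, b s.1 s.2 * _), Finset.sum_mul_sum, Finset.mul_sum,
        ← Finset.sum_add_distrib]
      refine Finset.sum_congr rfl fun s _ => ?_
      have h2 : ∀ t : T, ((⟨s.1, Sum.inl s.2⟩ : Σ k : Fin 2, Fin (n k) ⊕ ℕ) =
          ⟨t.1, Sum.inl t.2⟩) ↔ s = t := by
        rintro ⟨k, j⟩
        obtain ⟨k', j'⟩ := s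
        constructor
        · intro hh
          simp only [Sigma.mk.injEq] at hh
          obtain ⟨rfl, hh⟩ := hh
          rw [show j' = j by simpa using hh]
        · rintro hh
          cases hh
          rfl
      simp only [gramLimit, h2, mul_add, Finset.sum_add_distrib, mul_ite, mul_zero,
        Finset.sum_ite_eq, Finset.mem_univ, if_true]
      congr 1
      · ring
      · rw [Finset.mul_sum]
        refine Finset.sum_congr rfl fun t _ => ?_
        split_ifs <;> ring
    rw [h1, Finset.mul_sum]
    have h3 : ∑ s : T, τ * b s.1 s.2 ^ 2 ≤ ∑ s : T, τSq s.1 * b s.1 s.2 ^ 2 :=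
      Finset.sum_le_sum fun s _ => mul_le_mul_of_nonneg_right (hτk s.1) (sq_nonneg _)
    have h4 : 0 ≤ δ ^ 2 * (∑ s : T, b s.1 s.2 * (if s.1 = 0 then 1 else 0)) ^ 2 := by positivity
    linarith
  have h5 := coercive_of_close hε0.le hq (fun s => b s.1 s.2) hγ
  have h6 : combo (train X q.1 q.2) b =
      ∑ s : T, b s.1 s.2 • shiftedTrain pop X s.1 s.2 q := by
    -- The coefficients sum to zero, so the common shift drops out.
    rw [combo_eq_sum_sub _ (fun _ => pop.mean 1 q.1), ← Finset.sum_smul, hb, zero_smul, add_zero,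
      Fintype.sum_sigma]
    rfl
  have h7 : ‖combo (train X q.1 q.2) b‖ ^ 2 = q.1 * ∑ s : T, ∑ t : T, b s.1 s.2 * b t.1 t.2 *
      ((q.1 : ℝ)⁻¹ * ⟪shiftedTrain pop X s.1 s.2 q, shiftedTrain pop X t.1 t.2 q⟫_ℝ) := by
    rw [← real_inner_self_eq_norm_sq, h6, sum_inner, Finset.mul_sum]
    refine Finset.sum_congr rfl fun s _ => ?_
    rw [inner_sum, Finset.mul_sum]
    refine Finset.sum_congr rfl fun t _ => ?_
    rw [real_inner_smul_left, real_inner_smul_right]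
    field_simp
  have h8 : τ - ε * Fintype.card T = τ / 2 := by
    rw [hε]; field_simp; ring
  rw [h8] at h5
  rw [h7, ← Fintype.sum_sigma (fun s : T => b s.1 s.2 ^ 2)]
  calc τ / 2 * q.1 * ∑ s : T, b s.1 s.2 ^ 2 = q.1 * (τ / 2 * ∑ s : T, b s.1 s.2 ^ 2) := by ring
    _ ≤ _ := mul_le_mul_of_nonneg_left h5 hp'.le

/-- A vector that is asymptotically orthogonal to the centred training observations is
asymptotically orthogonal to their span, uniformly. -/
theorem WeakSpikeModel.eventually_abs_inner_combo_le (h : WeakSpikeModel P pop n X z δ τSq)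
    {V : (q : ℕ × Ω) → E q.1} {m : Fin 2 → (q : ℕ × Ω) → E q.1}
    (hV : ∀ k (j : Fin (n k)), GramTendsto P (fun q => train X q.1 q.2 k j - m k q) V 0)
    {ε : ℝ} (hε : 0 < ε) : ∀ᶠ q in probFilter P, ∀ b, ∑ k, classSum n b k = 0 →
      ∑ k, classSum n b k • m k q = 0 →
      |⟪combo (train X q.1 q.2) b, V q⟫_ℝ| ≤ ε * √q.1 * ‖combo (train X q.1 q.2) b‖ := by
  obtain ⟨c, hc, hco⟩ := h.exists_coercive
  set T := Σ k : Fin 2, Fin (n k)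
  have hT : (0 : ℝ) < Fintype.card T := by
    have : Nonempty T := ⟨⟨0, ⟨0, h.one_le 0⟩⟩⟩
    exact_mod_cast Fintype.card_pos
  -- Coercivity gives Σ |b| ≤ √(card T / (c p)) ‖combo‖, so an entrywise bound η p sums to ε √p
  -- ‖combo‖.
  set η : ℝ := ε * √(c / Fintype.card T) with hη
  have hη0 : 0 < η := by positivity
  have hev : ∀ᶠ q in probFilter P, ∀ s : T,
      |(q.1 : ℝ)⁻¹ * ⟪train X q.1 q.2 s.1 s.2 - m s.1 q, V q⟫_ℝ| ≤ η := by
    rw [eventually_all]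
    intro s
    filter_upwards [Metric.tendsto_nhds.1 (hV s.1 s.2) η hη0] with q hq
    rw [dist_zero_right, Real.norm_eq_abs] at hq
    exact hq.le
  have hp1 := (tendsto_fst_probFilter (P := P)).eventually (eventually_ge_atTop 1)
  filter_upwards [hco, hev, hp1] with q hq1 hq2 hp b hb hbm
  have hp' : (0 : ℝ) < q.1 := by exact_mod_cast hp
  have h1 := hq1 b hb
  rw [← Fintype.sum_sigma (fun s : T => b s.1 s.2 ^ 2)] at h1
  have h2 : |⟪combo (train X q.1 q.2) b, V q⟫_ℝ| ≤ η * q.1 * ∑ s : T, |b s.1 s.2| := by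
    rw [combo_eq_sum_sub _ (fun k => m k q), hbm, add_zero,
      ← Fintype.sum_sigma (fun s : T => b s.1 s.2 • (train X q.1 q.2 s.1 s.2 - m s.1 q)),
      sum_inner, Finset.mul_sum]
    refine (Finset.abs_sum_le_sum_abs _ _).trans (Finset.sum_le_sum fun s _ => ?_)
    rw [real_inner_smul_left, abs_mul, mul_comm]
    refine mul_le_mul_of_nonneg_right ?_ (abs_nonneg _)
    have h3 := hq2 s
    rwa [abs_mul, abs_of_pos (inv_pos.2 hp'), inv_mul_le_iff₀ hp', mul_comm] at h3
  refine h2.trans (le_of_sq_le_sq ?_ (by positivity))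
  have h4 := sq_sum_abs_le (fun s : T => b s.1 s.2)
  have h5 : η ^ 2 = ε ^ 2 * (c / Fintype.card T) := by
    rw [hη, mul_pow, Real.sq_sqrt (by positivity)]
  calc (η * q.1 * ∑ s : T, |b s.1 s.2|) ^ 2
      = ε ^ 2 * (c / Fintype.card T) * q.1 ^ 2 * (∑ s : T, |b s.1 s.2|) ^ 2 := by
        rw [mul_pow, mul_pow, h5]
    _ ≤ ε ^ 2 * (c / Fintype.card T) * q.1 ^ 2 * (Fintype.card T * ∑ s : T, b s.1 s.2 ^ 2) := by
        gcongr
    _ = ε ^ 2 * q.1 * (c * q.1 * ∑ s : T, b s.1 s.2 ^ 2) := by field_simp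
    _ ≤ ε ^ 2 * q.1 * ‖combo (train X q.1 q.2) b‖ ^ 2 := by gcongr
    _ = (ε * √q.1 * ‖combo (train X q.1 q.2) b‖) ^ 2 := by
        rw [mul_pow, mul_pow, Real.sq_sqrt hp'.le]

end Limits

/-! ### Limits along w_MDP and second maximal directions. -/

section SecondPiling

variable {Ω : Type*} [MeasurableSpace Ω] {P : Measure Ω}
  {pop : Population} {n : Fin 2 → ℕ} {X : (p : ℕ) → (k : Fin 2) → Fin (n k) ⊕ ℕ → Ω → E p}
  {z : (k : Fin 2) → Fin (n k) ⊕ ℕ → ℕ → Ω → ℝ} {δ : ℝ} {τSq : Fin 2 → ℝ}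

/-- The limit `κ₀` of the maximal data piling distance. -/
noncomputable def limitDistance (n : Fin 2 → ℕ) (δ : ℝ) (τSq : Fin 2 → ℝ) : ℝ :=
  √(δ ^ 2 + τSq 0 / n 0 + τSq 1 / n 1)

theorem WeakSpikeModel.sq_limitDistance (h : WeakSpikeModel P pop n X z δ τSq) :
    limitDistance n δ τSq ^ 2 = δ ^ 2 + τSq 0 / n 0 + τSq 1 / n 1 := by
  have h0 := h.spiked.limit_pos 0
  have h1 := h.spiked.limit_pos 1
  rw [limitDistance, Real.sq_sqrt (by positivity)]

theorem WeakSpikeModel.limitDistance_pos (h : WeakSpikeModel P pop n X z δ τSq) :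
    0 < limitDistance n δ τSq := by
  have h0 := h.spiked.limit_pos 0
  have h1 := h.spiked.limit_pos 1
  have h2 := h.meanGap.1
  exact Real.sqrt_pos.2 (by positivity)

theorem eventually_mem_directions {w : (p : ℕ) → Sample n p → E p} (hw : w ∈ directions P X) :
    ∀ᶠ q in probFilter P, w q.1 (train X q.1 q.2) ∈ sampleSpace (train X q.1 q.2) ∧
      ‖w q.1 (train X q.1 q.2)‖ = 1 := by
  apply eventually_probFilter_of_ae
  filter_upwards [show ∀ᶠ p in atTop, _ from hw] with p hp using hp.2

variable [IsProbabilityMeasure P]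

theorem WeakSpikeModel.eventually_mdp_eq (h : WeakSpikeModel P pop n X z δ τSq) :
    ∀ᶠ q in probFilter P, kernelDiff (train X q.1 q.2) ≠ 0 ∧ mdp (train X q.1 q.2) =
      ‖kernelDiff (train X q.1 q.2)‖⁻¹ • kernelDiff (train X q.1 q.2) := by
  apply eventually_probFilter_of_ae
  filter_upwards [eventually_ge_atTop (n 0 + n 1)] with p hp using h.obs.ae_mdp_eq h.one_le hp

theorem WeakSpikeModel.tendsto_norm_meanDiff (h : WeakSpikeModel P pop n X z δ τSq) :
    Tendsto (fun q : ℕ × Ω => (√(q.1 : ℝ))⁻¹ * ‖meanDiff (train X q.1 q.2)‖) (probFilter P)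
      (𝓝 (limitDistance n δ τSq)) :=
  h.gramTendsto_meanDiff_self.norm

theorem inv_mul_le_of_le_mul {p : ℕ} (hp : 1 ≤ p) {a ε : ℝ} (h : a ≤ ε * √(p : ℝ)) :
    (√(p : ℝ))⁻¹ * a ≤ ε := by
  have hp' : 0 < √(p : ℝ) := Real.sqrt_pos.2 (by exact_mod_cast hp)
  rw [inv_mul_le_iff₀ hp']
  linarith

/-- The component of the mean difference in the range of `S_W` is negligible. -/
theorem WeakSpikeModel.tendsto_norm_meanDiff_sub (h : WeakSpikeModel P pop n X z δ τSq) :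
    Tendsto (fun q : ℕ × Ω => (√(q.1 : ℝ))⁻¹ *
      ‖meanDiff (train X q.1 q.2) - kernelDiff (train X q.1 q.2)‖) (probFilter P) (𝓝 0) := by
  refine tendsto_order.2 ⟨fun a ha => Eventually.of_forall fun q => ha.trans_le (by positivity),
    fun ε hε => ?_⟩
  have hp1 := (tendsto_fst_probFilter (P := P)).eventually (eventually_ge_atTop 1)
  filter_upwards [h.eventually_abs_inner_combo_le h.gramTendsto_sub_classMean (half_pos hε), hp1]
    with q hq hp
  have hy := meanDiff_sub_kernelDiff_mem (train X q.1 q.2)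
  have h1 := (Submodule.mem_orthogonal _ _).1 (kernelDiff_mem (train X q.1 q.2)) _ hy
  have h2 := hy
  rw [withinSpace_eq_map h.one_le] at h2
  obtain ⟨b, hb, hby⟩ := h2
  rw [SetLike.mem_coe, LinearMap.mem_ker] at hb
  have h3 := hq b (by simp [hb]) (by simp [hb])
  rw [hby] at h3
  -- The difference y = d - `kernelDiff` lies in the within space and is orthogonal to `kernelDiff`.
  -- Hence ⟪y, d⟫ = ‖y‖², and the uniform bound becomes ‖y‖² ≤ (ε / 2) √p ‖y‖.
  have h4 : ⟪meanDiff (train X q.1 q.2) - kernelDiff (train X q.1 q.2),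
      meanDiff (train X q.1 q.2)⟫_ℝ =
      ‖meanDiff (train X q.1 q.2) - kernelDiff (train X q.1 q.2)‖ ^ 2 := by
    rw [← real_inner_self_eq_norm_sq, inner_sub_right _ _ (kernelDiff _), h1, sub_zero]
  rw [h4, abs_of_nonneg (sq_nonneg _), sq] at h3
  refine (inv_mul_le_of_le_mul hp (ε := ε / 2) ?_).trans_lt (half_lt_self hε)
  rcases (norm_nonneg (meanDiff (train X q.1 q.2) - kernelDiff (train X q.1 q.2))).eq_or_lt
    with h5 | h5
  · rw [← h5]; positivity
  · exact le_of_mul_le_mul_right h3 h5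

theorem WeakSpikeModel.tendsto_norm_kernelDiff (h : WeakSpikeModel P pop n X z δ τSq) :
    Tendsto (fun q : ℕ × Ω => (√(q.1 : ℝ))⁻¹ * ‖kernelDiff (train X q.1 q.2)‖) (probFilter P)
      (𝓝 (limitDistance n δ τSq)) := by
  have h1 : Tendsto (fun q : ℕ × Ω => (√(q.1 : ℝ))⁻¹ * ‖kernelDiff (train X q.1 q.2)‖ -
      (√(q.1 : ℝ))⁻¹ * ‖meanDiff (train X q.1 q.2)‖) (probFilter P) (𝓝 0) := by
    refine squeeze_zero_norm (fun q => ?_) h.tendsto_norm_meanDiff_sub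
    rw [← mul_sub, norm_mul, Real.norm_of_nonneg (by positivity)]
    refine mul_le_mul_of_nonneg_left ?_ (by positivity)
    rw [norm_sub_rev (meanDiff _)]
    exact abs_norm_sub_norm_le _ _
  simpa using h1.add h.tendsto_norm_meanDiff

theorem WeakSpikeModel.tendsto_kappaMDP (h : WeakSpikeModel P pop n X z δ τSq) :
    Tendsto (fun q : ℕ × Ω => kappaMDP (train X q.1 q.2)) (probFilter P)
      (𝓝 (limitDistance n δ τSq)) := by
  refine h.tendsto_norm_kernelDiff.congr' ?_
  filter_upwards [h.eventually_mdp_eq] with q ⟨hq, hm⟩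
  have h1 : ⟪mdp (train X q.1 q.2), meanDiff (train X q.1 q.2)⟫_ℝ =
      ‖kernelDiff (train X q.1 q.2)‖ := by
    rw [hm, real_inner_smul_left, inner_meanDiff_eq _ (kernelDiff_mem _),
      real_inner_self_eq_norm_sq]
    have := norm_ne_zero_iff.2 hq
    field_simp
  rw [kappaMDP, ← meanDiff, h1, abs_norm]

/-- The projections onto `w_MDP` are asymptotically determined by those onto the mean
difference. -/
theorem WeakSpikeModel.tendsto_inner_mdp (h : WeakSpikeModel P pop n X z δ τSq)
    {V : (q : ℕ × Ω) → E q.1} {a c : ℝ}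
    (hV : GramTendsto P V (fun q => meanDiff (train X q.1 q.2)) c) (hVV : GramTendsto P V V a) :
    Tendsto (fun q : ℕ × Ω => (√(q.1 : ℝ))⁻¹ * ⟪mdp (train X q.1 q.2), V q⟫_ℝ) (probFilter P)
      (𝓝 ((limitDistance n δ τSq)⁻¹ * c)) := by
  -- Replacing d by its projection costs at most ‖d - `kernelDiff`‖ ‖V‖ / p, and `hVV` keeps ‖V‖ /
  -- √p bounded.
  have h1 : Tendsto (fun q : ℕ × Ω => (q.1 : ℝ)⁻¹ *
      ⟪meanDiff (train X q.1 q.2) - kernelDiff (train X q.1 q.2), V q⟫_ℝ) (probFilter P)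
      (𝓝 0) := by
    have h2 := h.tendsto_norm_meanDiff_sub.mul hVV.norm
    rw [zero_mul] at h2
    refine squeeze_zero_norm (fun q => ?_) h2
    have h3 : (q.1 : ℝ)⁻¹ = (√(q.1 : ℝ))⁻¹ * (√(q.1 : ℝ))⁻¹ := by
      rw [← mul_inv, Real.mul_self_sqrt (by positivity)]
    rw [norm_mul, Real.norm_of_nonneg (by positivity), h3, mul_mul_mul_comm]
    exact mul_le_mul_of_nonneg_left (abs_real_inner_le_norm _ _) (by positivity)
  have h4 := (Tendsto.inv₀ h.tendsto_norm_kernelDiff h.limitDistance_pos.ne').mul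
    (Tendsto.sub hV.symm h1)
  rw [sub_zero] at h4
  refine h4.congr' ?_
  have hp1 := (tendsto_fst_probFilter (P := P)).eventually (eventually_ge_atTop 1)
  filter_upwards [h.eventually_mdp_eq, hp1] with q ⟨hq, hm⟩ hp
  have hp' : 0 < √(q.1 : ℝ) := Real.sqrt_pos.2 (by exact_mod_cast hp)
  have h3 : (q.1 : ℝ)⁻¹ = (√(q.1 : ℝ))⁻¹ * (√(q.1 : ℝ))⁻¹ := by
    rw [← mul_inv, Real.mul_self_sqrt (by positivity)]
  have := norm_ne_zero_iff.2 hq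
  rw [hm, real_inner_smul_left, inner_sub_left, h3]
  field_simp
  ring

theorem WeakSpikeModel.tendsto_inner_mdp_test (h : WeakSpikeModel P pop n X z δ τSq)
    (k : Fin 2) (l : ℕ) :
    Tendsto (fun q : ℕ × Ω => (√(q.1 : ℝ))⁻¹ * ⟪mdp (train X q.1 q.2),
      test X q.1 k l q.2 - totalMean (train X q.1 q.2)⟫_ℝ) (probFilter P)
      (𝓝 ((limitDistance n δ τSq)⁻¹ *
        ((if k = 0 then n 1 / ((n 0 : ℝ) + n 1) else -(n 0 / ((n 0 : ℝ) + n 1))) * δ ^ 2 -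
        (τSq 0 - τSq 1) / ((n 0 : ℝ) + n 1)))) := by
  obtain ⟨a, ha⟩ := h.exists_gramTendsto_test_sub_totalMean k l
  exact h.tendsto_inner_mdp (h.gramTendsto_test_sub_totalMean k l) ha

theorem WeakSpikeModel.tendsto_inner_projectedRidge_test
    (h : WeakSpikeModel P pop n X z δ τSq) (α : ℝ) (k : Fin 2) (l : ℕ) :
    Tendsto (fun q : ℕ × Ω => (√(q.1 : ℝ))⁻¹ * ⟪projectedRidge P pop X α (train X q.1 q.2),
      test X q.1 k l q.2 - totalMean (train X q.1 q.2)⟫_ℝ) (probFilter P)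
      (𝓝 ((limitDistance n δ τSq)⁻¹ *
        ((if k = 0 then n 1 / ((n 0 : ℝ) + n 1) else -(n 0 / ((n 0 : ℝ) + n 1))) * δ ^ 2 -
        (τSq 0 - τSq 1) / ((n 0 : ℝ) + n 1)))) := by
  refine (h.tendsto_inner_mdp_test k l).congr' ?_
  have : ∀ᶠ q in probFilter P, projectedRidge P pop X α (train X q.1 q.2) =
      mdp (train X q.1 q.2) := by
    apply eventually_probFilter_of_ae
    filter_upwards [eventually_ge_atTop (n 0 + n 1)] with p hp
    filter_upwards [h.obs.ae_projectedRidge_eq_mdp h.one_le h.weak hp] with ω hω using hω α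
  filter_upwards [this] with q hq
  rw [hq]

/-- Directions in the sample space do not see vectors asymptotically orthogonal to the centred
training observations. -/
theorem WeakSpikeModel.tendsto_inner_direction (h : WeakSpikeModel P pop n X z δ τSq)
    {w : (p : ℕ) → Sample n p → E p} (hw : w ∈ directions P X)
    {V : (q : ℕ × Ω) → E q.1} {c : ℝ}
    (hV : ∀ k (j : Fin (n k)), GramTendsto P (shiftedTrain pop X k j) V c) :
    Tendsto (fun q : ℕ × Ω => (√(q.1 : ℝ))⁻¹ * ⟪w q.1 (train X q.1 q.2), V q⟫_ℝ)
      (probFilter P) (𝓝 0) := by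
  rw [Metric.tendsto_nhds]
  intro ε hε
  have hp1 := (tendsto_fst_probFilter (P := P)).eventually (eventually_ge_atTop 1)
  filter_upwards [h.eventually_abs_inner_combo_le (m := fun _ q => totalMean (train X q.1 q.2))
    (h.gramTendsto_sub_totalMean hV) (half_pos hε), hp1, eventually_mem_directions hw]
    with q hq hp ⟨hwS, hw1⟩
  obtain ⟨b, hb, hbw⟩ := exists_combo_of_mem_sampleSpace h.one_le hwS
  have h1 := hq b hb (by rw [← Finset.sum_smul, hb, zero_smul])
  rw [hbw, hw1, mul_one] at h1
  rw [dist_zero_right, norm_mul, Real.norm_of_nonneg (by positivity)]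
  exact (inv_mul_le_of_le_mul hp h1).trans_lt (half_lt_self hε)

/-- Test observations of one class have equal limiting inner products with each training
observation, so their difference is invisible to directions in the sample space. -/
theorem WeakSpikeModel.directions_subset (h : WeakSpikeModel P pop n X z δ τSq) :
    directions P X ⊆ secondDataPiling P X := by
  intro w hw
  refine ⟨hw, fun k l l' => tendstoInMeasure_iff.2 ?_⟩
  refine h.tendsto_inner_direction (c := 0) hw
    (V := fun q => test X q.1 k l q.2 - test X q.1 k l' q.2) fun i j => ?_
  have h1 := (h.gramTendsto_shifted ⟨i, Sum.inl j⟩ ⟨k, Sum.inr l⟩).sub_right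
    (h.gramTendsto_shifted ⟨i, Sum.inl j⟩ ⟨k, Sum.inr l'⟩)
  simp only [shifted, sub_sub_sub_cancel_right] at h1
  have e : (0 : ℝ) = gramLimit δ τSq ⟨i, Sum.inl j⟩ ⟨k, Sum.inr l⟩ -
      gramLimit δ τSq ⟨i, Sum.inl j⟩ ⟨k, Sum.inr l'⟩ := by
    have h2 : ∀ l, (⟨i, Sum.inl j⟩ : Σ k : Fin 2, Fin (n k) ⊕ ℕ) ≠ ⟨k, Sum.inr l⟩ := by
      rintro l hh
      cases hh
    simp [gramLimit, h2]
  rw [e]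
  exact h1

/-- The asymptotic distance between the test data piles along a direction is proportional to the
cosine of its angle with `w_MDP`. -/
theorem WeakSpikeModel.tendsto_abs_inner_direction_sub (h : WeakSpikeModel P pop n X z δ τSq)
    {w : (p : ℕ) → Sample n p → E p} (hw : w ∈ directions P X) (l l' : ℕ) :
    Tendsto (fun q : ℕ × Ω => (√(q.1 : ℝ))⁻¹ * |⟪w q.1 (train X q.1 q.2),
      test X q.1 0 l q.2 - test X q.1 1 l' q.2⟫_ℝ| - δ ^ 2 / limitDistance n δ τSq *
      |⟪w q.1 (train X q.1 q.2), mdp (train X q.1 q.2)⟫_ℝ|) (probFilter P) (𝓝 0) := by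
  set κ := limitDistance n δ τSq with hκ
  have hκ0 : 0 < κ := h.limitDistance_pos
  have hκ2 : κ ^ 2 = _ := h.sq_limitDistance
  -- The limits of ⟪x, Y₁ - Y₂ - r d⟫ / p are δ² - r (τ₁² / n₁ + δ²) for x in class 1 and r τ₂² / n₂
  -- for x in class 2. They agree exactly when r κ² = δ².
  set r : ℝ := δ ^ 2 / κ ^ 2 with hr
  have hr0 : 0 ≤ r := by positivity
  have hA := h.tendsto_inner_direction (c := r * (τSq 1 / n 1)) hw
    (V := fun q => test X q.1 0 l q.2 - test X q.1 1 l' q.2 -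
      r • meanDiff (train X q.1 q.2)) (by
    intro k j
    have h2 := ((h.gramTendsto_shifted ⟨k, Sum.inl j⟩ ⟨0, Sum.inr l⟩).sub_right
      (h.gramTendsto_shifted ⟨k, Sum.inl j⟩ ⟨1, Sum.inr l'⟩)).sub_right
      ((h.gramTendsto_train_meanDiff k j).smul_right r)
    simp only [shifted, sub_sub_sub_cancel_right] at h2
    have e : r * (τSq 1 / n 1) = gramLimit δ τSq ⟨k, Sum.inl j⟩ ⟨0, Sum.inr l⟩ -
        gramLimit δ τSq ⟨k, Sum.inl j⟩ ⟨1, Sum.inr l'⟩ - r * diffLimit n δ τSq k := by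
      have h3 : r * κ ^ 2 = δ ^ 2 := by rw [hr]; field_simp
      rw [hκ2] at h3
      fin_cases k
      · simp [gramLimit, diffLimit]
        linarith
      · simp [gramLimit, diffLimit]
    rw [e]
    exact h2)
  have hB := ((h.tendsto_norm_meanDiff_sub.add
    (tendsto_iff_dist_tendsto_zero.1 h.tendsto_norm_kernelDiff)).const_mul r)
  have hC := hA.norm.add hB
  simp only [norm_zero, add_zero, mul_zero] at hC
  refine squeeze_zero_norm' ?_ hC
  filter_upwards [eventually_mem_directions hw, h.eventually_mdp_eq] with q ⟨_, hw1⟩ ⟨hne, hm⟩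
  set W := w q.1 (train X q.1 q.2)
  set d := meanDiff (train X q.1 q.2)
  set k := kernelDiff (train X q.1 q.2)
  set Y := test X q.1 0 l q.2 - test X q.1 1 l' q.2
  set s : ℝ := (√(q.1 : ℝ))⁻¹ with hs
  have hs0 : 0 ≤ s := by positivity
  have hk : 0 < ‖k‖ := norm_pos_iff.2 hne
  have hkm : k = ‖k‖ • mdp (train X q.1 q.2) := by
    rw [hm, smul_smul, mul_inv_cancel₀ hk.ne', one_smul]
  have hm1 : ‖mdp (train X q.1 q.2)‖ = 1 := by
    rw [hm, norm_smul, norm_inv, norm_norm, inv_mul_cancel₀ hk.ne']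
  set M := mdp (train X q.1 q.2)
  have hWM : |⟪W, M⟫_ℝ| ≤ 1 := by
    have := abs_real_inner_le_norm W M
    rwa [hw1, hm1, one_mul] at this
  -- The first summand is invisible to W. The next two replace d by its projection and the length of
  -- the projection by κ; the last is the main term.
  have hdec : s * ⟪W, Y⟫_ℝ = s * ⟪W, Y - r • d⟫_ℝ + r * (s * ⟪W, d - k⟫_ℝ) +
      r * ((s * ‖k‖ - κ) * ⟪W, M⟫_ℝ) + r * κ * ⟪W, M⟫_ℝ := by
    have h2 : ⟪W, k⟫_ℝ = ‖k‖ * ⟪W, M⟫_ℝ := by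
      conv_lhs => rw [hkm]
      rw [real_inner_smul_right]
    rw [inner_sub_right W Y, inner_sub_right W d k, real_inner_smul_right, h2]
    ring
  have hrκ : δ ^ 2 / κ = r * κ := by rw [hr]; field_simp
  have hy : |s * ⟪W, d - k⟫_ℝ| ≤ s * ‖d - k‖ := by
    rw [abs_mul, abs_of_nonneg hs0]
    have := abs_real_inner_le_norm W (d - k)
    rw [hw1, one_mul] at this
    exact mul_le_mul_of_nonneg_left this hs0
  have hz : |(s * ‖k‖ - κ) * ⟪W, M⟫_ℝ| ≤ |s * ‖k‖ - κ| := by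
    rw [abs_mul]
    exact mul_le_of_le_one_right (abs_nonneg _) hWM
  calc ‖s * |⟪W, Y⟫_ℝ| - δ ^ 2 / κ * |⟪W, M⟫_ℝ|‖
      = |(|s * ⟪W, Y⟫_ℝ| - |r * κ * ⟪W, M⟫_ℝ|)| := by
        rw [hrκ, abs_mul s, abs_of_nonneg hs0, abs_mul (r * κ), abs_of_nonneg (by positivity :
          0 ≤ r * κ), Real.norm_eq_abs]
    _ ≤ |s * ⟪W, Y⟫_ℝ - r * κ * ⟪W, M⟫_ℝ| := abs_abs_sub_abs_le _ _
    _ = |s * ⟪W, Y - r • d⟫_ℝ + (r * (s * ⟪W, d - k⟫_ℝ) +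
        r * ((s * ‖k‖ - κ) * ⟪W, M⟫_ℝ))| := by
        rw [hdec]; congr 1; ring
    _ ≤ |s * ⟪W, Y - r • d⟫_ℝ| + (|r * (s * ⟪W, d - k⟫_ℝ)| +
        |r * ((s * ‖k‖ - κ) * ⟪W, M⟫_ℝ)|) :=
        (abs_add_le _ _).trans (by gcongr; exact abs_add_le _ _)
    _ ≤ ‖s * ⟪W, Y - r • d⟫_ℝ‖ + r * (s * ‖d - k‖ + dist (s * ‖k‖) κ) := by
        rw [abs_mul r, abs_mul r, abs_of_nonneg hr0, Real.norm_eq_abs, Real.dist_eq, mul_add]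
        gcongr

theorem WeakSpikeModel.hasPilingDistance_iff (h : WeakSpikeModel P pop n X z δ τSq)
    {w : (p : ℕ) → Sample n p → E p} (hw : w ∈ directions P X) (D : Ω → ℝ) :
    HasPilingDistance P X w D ↔ Tendsto (fun q : ℕ × Ω => δ ^ 2 / limitDistance n δ τSq *
      |⟪w q.1 (train X q.1 q.2), mdp (train X q.1 q.2)⟫_ℝ| - D q.2) (probFilter P) (𝓝 0) := by
  constructor
  · intro hD
    have h1 := (tendstoInMeasure_iff_sub.1 (hD 0 0)).sub (h.tendsto_abs_inner_direction_sub hw 0 0)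
    rw [sub_zero] at h1
    exact h1.congr fun q => by ring
  · intro hD l l'
    rw [tendstoInMeasure_iff_sub]
    have h1 := hD.add (h.tendsto_abs_inner_direction_sub hw l l')
    rw [add_zero] at h1
    exact h1.congr fun q => by ring

theorem WeakSpikeModel.eventually_norm_mdp (h : WeakSpikeModel P pop n X z δ τSq) :
    ∀ᶠ q in probFilter P, ‖mdp (train X q.1 q.2)‖ = 1 := by
  filter_upwards [eventually_mem_directions (h.obs.mdp_mem_directions h.one_le)] with q hq
    using hq.2

theorem WeakSpikeModel.pilingDistance_le (h : WeakSpikeModel P pop n X z δ τSq)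
    {w : (p : ℕ) → Sample n p → E p} (hw : w ∈ directions P X) {D : Ω → ℝ}
    (hD : HasPilingDistance P X w D) : D ≤ᵐ[P] fun _ => δ ^ 2 / limitDistance n δ τSq := by
  have hκ0 := h.limitDistance_pos
  refine ae_le_of_probFilter fun ε hε => ?_
  filter_upwards [Metric.tendsto_nhds.1 ((h.hasPilingDistance_iff hw D).1 hD) ε hε,
    eventually_mem_directions hw, h.eventually_norm_mdp] with q hq ⟨_, hw1⟩ hm1
  have hWM := abs_real_inner_le_norm (w q.1 (train X q.1 q.2)) (mdp (train X q.1 q.2))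
  rw [hw1, hm1, one_mul] at hWM
  rw [dist_zero_right, Real.norm_eq_abs] at hq
  have h1 := (abs_lt.1 hq).1
  have h2 : δ ^ 2 / limitDistance n δ τSq *
      |⟪w q.1 (train X q.1 q.2), mdp (train X q.1 q.2)⟫_ℝ| ≤ δ ^ 2 / limitDistance n δ τSq :=
    mul_le_of_le_one_right (by positivity) hWM
  linarith

theorem WeakSpikeModel.hasPilingDistance_mdp (h : WeakSpikeModel P pop n X z δ τSq) :
    HasPilingDistance P X (fun _ x => mdp x) (fun _ => δ ^ 2 / limitDistance n δ τSq) := by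
  rw [h.hasPilingDistance_iff (h.obs.mdp_mem_directions h.one_le)]
  refine tendsto_const_nhds.congr' ?_
  filter_upwards [h.eventually_norm_mdp] with q hq
  rw [real_inner_self_eq_norm_sq, hq]
  simp

theorem WeakSpikeModel.isSecondMaximal_mdp (h : WeakSpikeModel P pop n X z δ τSq) :
    IsSecondMaximal P X (fun _ x => mdp x) :=
  ⟨h.directions_subset (h.obs.mdp_mem_directions h.one_le), _, h.hasPilingDistance_mdp,
    fun _ hv _ hD' => h.pilingDistance_le hv.1 hD'⟩

/-- Every existing distance is at most δ² / κ₀ by Cauchy–Schwarz, and w_MDP attains this value. So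
maximality means that the distance equals this constant almost surely, that is, that the cosine
tends to 1 in absolute value. -/
theorem WeakSpikeModel.isSecondMaximal_iff_tendsto (h : WeakSpikeModel P pop n X z δ τSq)
    {w : (p : ℕ) → Sample n p → E p} (hw : w ∈ directions P X) :
    IsSecondMaximal P X w ↔ Tendsto (fun q : ℕ × Ω =>
      |⟪w q.1 (train X q.1 q.2), mdp (train X q.1 q.2)⟫_ℝ|) (probFilter P) (𝓝 1) := by
  have hκ0 := h.limitDistance_pos
  have hδ := h.meanGap.1
  have hc : δ ^ 2 / limitDistance n δ τSq ≠ 0 := by positivity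
  have key : HasPilingDistance P X w (fun _ => δ ^ 2 / limitDistance n δ τSq) ↔
      Tendsto (fun q : ℕ × Ω =>
        |⟪w q.1 (train X q.1 q.2), mdp (train X q.1 q.2)⟫_ℝ|) (probFilter P) (𝓝 1) := by
    rw [h.hasPilingDistance_iff hw, tendsto_sub_nhds_zero_iff]
    constructor
    · intro h1
      have h2 := h1.const_mul (δ ^ 2 / limitDistance n δ τSq)⁻¹
      rw [inv_mul_cancel₀ hc] at h2
      exact h2.congr fun q => inv_mul_cancel_left₀ hc _
    · intro h1
      have h2 := h1.const_mul (δ ^ 2 / limitDistance n δ τSq)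
      rwa [mul_one] at h2
  rw [← key]
  constructor
  · rintro ⟨-, D, hD, hmax⟩
    have h1 := hmax _ h.isSecondMaximal_mdp.1 _ h.hasPilingDistance_mdp
    have h2 := h.pilingDistance_le hw hD
    intro l l'
    exact (hD l l').congr_right (h2.antisymm h1)
  · intro hD
    exact ⟨h.directions_subset hw, _, hD, fun _ hv _ hD' => h.pilingDistance_le hv.1 hD'⟩

theorem sq_min_norm_sub_norm_add {V : Type*} [NormedAddCommGroup V] [InnerProductSpace ℝ V]
    {a b : V} (ha : ‖a‖ = 1) (hb : ‖b‖ = 1) :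
    min ‖a - b‖ ‖a + b‖ ^ 2 = 2 - 2 * |⟪a, b⟫_ℝ| := by
  have h1 := norm_sub_sq_real a b
  have h2 := norm_add_sq_real a b
  rw [ha, hb] at h1 h2
  rcases le_total 0 ⟪a, b⟫_ℝ with h | h
  · rw [min_eq_left (le_of_sq_le_sq (by linarith) (norm_nonneg _)), abs_of_nonneg h]
    linarith
  · rw [min_eq_right (le_of_sq_le_sq (by linarith) (norm_nonneg _)), abs_of_nonpos h]
    linarith

theorem WeakSpikeModel.isSecondMaximal_iff (h : WeakSpikeModel P pop n X z δ τSq)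
    {w : (p : ℕ) → Sample n p → E p} (hw : w ∈ directions P X) :
    IsSecondMaximal P X w ↔ Tendsto (fun q : ℕ × Ω =>
      min ‖w q.1 (train X q.1 q.2) - mdp (train X q.1 q.2)‖
        ‖w q.1 (train X q.1 q.2) + mdp (train X q.1 q.2)‖) (probFilter P) (𝓝 0) := by
  rw [h.isSecondMaximal_iff_tendsto hw]
  have hev : ∀ᶠ q in probFilter P, min ‖w q.1 (train X q.1 q.2) - mdp (train X q.1 q.2)‖
        ‖w q.1 (train X q.1 q.2) + mdp (train X q.1 q.2)‖ ^ 2 =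
      2 - 2 * |⟪w q.1 (train X q.1 q.2), mdp (train X q.1 q.2)⟫_ℝ| := by
    filter_upwards [eventually_mem_directions hw, h.eventually_norm_mdp] with q hq hm
    exact sq_min_norm_sub_norm_add hq.2 hm
  constructor
  · intro h1
    have h2 := (h1.const_mul 2).const_sub 2
    have h3 := (Real.continuous_sqrt.tendsto _).comp h2
    rw [mul_one, sub_self, Real.sqrt_zero] at h3
    refine h3.congr' ?_
    filter_upwards [hev] with q hq
    rw [Function.comp_apply, ← hq, Real.sqrt_sq (by positivity)]
  · intro h1
    have h2 := ((h1.pow 2).const_sub 2).div_const 2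
    have e : ((2 : ℝ) - 0 ^ 2) / 2 = 1 := by norm_num
    rw [e] at h2
    refine h2.congr' ?_
    filter_upwards [hev] with q hq
    rw [hq]
    ring

end SecondPiling

end DoubleDataPiling

theorem mainTheorem8 {Ω : Type*} [MeasurableSpace Ω] (P : Measure Ω) [IsProbabilityMeasure P]
    (pop : Population) (n : Fin 2 → ℕ) (hn : ∀ k, 1 ≤ n k)
    (X : (p : ℕ) → (k : Fin 2) → Fin (n k) ⊕ ℕ → Ω → E p)
    (z : (k : Fin 2) → Fin (n k) ⊕ ℕ → ℕ → Ω → ℝ)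
    (δ : ℝ) (τSq : Fin 2 → ℝ) (θ : Fin 2 → ℕ → ℝ)
    (hmean : pop.MeanGapAsymptotics δ)
    (hcov : pop.SpikedCovariances τSq)
    (hobs : IsObservationModel P pop n X z)
    (hangle : pop.LimitingAngles θ)
    (hweak : ∀ k, pop.spikeExp k < 1)
    (N : ℝ) (hN : N = (n 0 : ℝ) + n 1)
    (κ₀ : ℝ) (hκ₀ : κ₀ = √(δ ^ 2 + τSq 0 / n 0 + τSq 1 / n 1)) :
    -- for every `α`, `v_α` is the maximal data piling direction
    (∀ p : ℕ, n 0 + n 1 ≤ p → ∀ᵐ ω ∂P, ∀ α : ℝ,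
      projectedRidge P pop X α (train X p ω) = mdp (train X p ω)) ∧
    -- `κ₀` is positive and is the limit in probability of `κ_MDP`
    0 < κ₀ ∧
    TendstoInMeasure P (fun (p : ℕ) ω => kappaMDP (train X p ω)) atTop (fun _ => κ₀) ∧
    -- limits of the projections of test data of class 1
    (∀ l : ℕ,
      TendstoInMeasure P (fun (p : ℕ) ω => (√(p : ℝ))⁻¹ *
          ⟪mdp (train X p ω), test X p 0 l ω - totalMean (train X p ω)⟫_ℝ)
        atTop (fun _ => κ₀⁻¹ * (n 1 / N * δ ^ 2 - (τSq 0 - τSq 1) / N)) ∧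
      ∀ α : ℝ, TendstoInMeasure P (fun (p : ℕ) ω => (√(p : ℝ))⁻¹ *
          ⟪projectedRidge P pop X α (train X p ω),
            test X p 0 l ω - totalMean (train X p ω)⟫_ℝ)
        atTop (fun _ => κ₀⁻¹ * (n 1 / N * δ ^ 2 - (τSq 0 - τSq 1) / N))) ∧
    -- limits of the projections of test data of class 2
    (∀ l : ℕ,
      TendstoInMeasure P (fun (p : ℕ) ω => (√(p : ℝ))⁻¹ *
          ⟪mdp (train X p ω), test X p 1 l ω - totalMean (train X p ω)⟫_ℝ)
        atTop (fun _ => κ₀⁻¹ * (-(n 0 / N) * δ ^ 2 - (τSq 0 - τSq 1) / N)) ∧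
      ∀ α : ℝ, TendstoInMeasure P (fun (p : ℕ) ω => (√(p : ℝ))⁻¹ *
          ⟪projectedRidge P pop X α (train X p ω),
            test X p 1 l ω - totalMean (train X p ω)⟫_ℝ)
        atTop (fun _ => κ₀⁻¹ * (-(n 0 / N) * δ ^ 2 - (τSq 0 - τSq 1) / N))) ∧
    -- every sequence of second data piling directions is asymptotically close to a sequence of
    -- directions in the sample space, and all of the latter are second data piling directions
    (∀ w ∈ secondDataPiling P X, ∃ v ∈ directions P X,
      TendstoInMeasure P (fun (p : ℕ) ω => ‖w p (train X p ω) - v p (train X p ω)‖)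
        atTop (fun _ => 0)) ∧
    directions P X ⊆ secondDataPiling P X ∧
    -- `w_MDP` is a second maximal data piling direction, the only one up to asymptotic
    -- equivalence (and sign)
    IsSecondMaximal P X (fun _ x => mdp x) ∧
    (∀ w ∈ secondDataPiling P X, IsSecondMaximal P X w ↔
      TendstoInMeasure P (fun (p : ℕ) ω =>
          min ‖w p (train X p ω) - mdp (train X p ω)‖ ‖w p (train X p ω) + mdp (train X p ω)‖)
        atTop (fun _ => 0)) := by
  have h : WeakSpikeModel P pop n X z δ τSq := ⟨hn, hmean, hcov, hobs, hweak⟩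
  have hκ : κ₀ = limitDistance n δ τSq := hκ₀
  subst hN hκ
  refine ⟨fun p hp => hobs.ae_projectedRidge_eq_mdp hn hweak hp, h.limitDistance_pos,
    tendstoInMeasure_iff.2 h.tendsto_kappaMDP, fun l => ⟨?_, fun α => ?_⟩,
    fun l => ⟨?_, fun α => ?_⟩, fun w hw => ⟨w, hw.1, tendstoInMeasure_iff.2 ?_⟩,
    h.directions_subset, h.isSecondMaximal_mdp, fun w hw => ?_⟩
  · have h1 := h.tendsto_inner_mdp_test 0 l
    rw [if_pos rfl] at h1
    exact tendstoInMeasure_iff.2 h1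
  · have h1 := h.tendsto_inner_projectedRidge_test α 0 l
    rw [if_pos rfl] at h1
    exact tendstoInMeasure_iff.2 h1
  · have h1 := h.tendsto_inner_mdp_test 1 l
    rw [if_neg one_ne_zero] at h1
    exact tendstoInMeasure_iff.2 h1
  · have h1 := h.tendsto_inner_projectedRidge_test α 1 l
    rw [if_neg one_ne_zero] at h1
    exact tendstoInMeasure_iff.2 h1
  -- Members of 𝒜 are directions in the sample space by definition, so w itself is the witness.
  · refine (tendsto_const_nhds (x := (0 : ℝ))).congr fun q => ?_
    rw [sub_self, norm_zero]
  · rw [h.isSecondMaximal_iff hw.1, tendstoInMeasure_iff]
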